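/- Let $\Bbbk$ be a field of characteristic zero and let $P$ be a symmetric $\Bbbk$-linear operad generated by binary operations, with a presentation by a set $V$ of binary generators and a family $S$ of relations (linear combinations of binary trees with leaves labelled bijectively by $1,\dots,n$). Let $\mathrm{DSu}(P)$ be the disuccessor of $P$: it is generated by binary operations $\omega_\prec,\omega_\succ$ ($\omega\in V$), subject to all relations obtained from a relation $r\in S$ and a leaf $x$ by replacing, in each tree of $r$, every vertex $\omega$ on the path from the root to $x$ by $\omega_\prec$ (if the path turns left there) or $\omega_\succ$ (if it turns right), and every other vertex $\omega$ by $\omega_\prec+\omega_\succ$. Let $\mathrm{RB}(P)$ be the operad of $P$-algebras with an operator $R$ satisfying $\omega(R(a_1),R(a_2))=R(\omega(R(a_1),a_2)+\omega(a_1,R(a_2)))$ for all $\omega\in V$. Let $\mathrm{Com}$ be the operad of commutative associative algebras, with product $\mu$, and let $\mathrm{Zinb}$ be the operad with one binary generator $\nu$ and the relation $\nu(a_1,\nu(a_2,a_3))=\nu(\nu(a_1,a_2),a_3)+\nu(\nu(a_2,a_1),a_3)$; write $\nu^{\mathrm{op}}(a_1,a_2)=\nu(a_2,a_1)$. Let $\otimes_{\mathrm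 H}$ denote the Hadamard product of operads, $(P\otimes_{\mathrm H}Q)(n)=P(n)\otimes Q(n)$. Then $\mathrm{DSu}(\mathrm{Com})\cong\mathrm{Zinb}$ via $\mu_\succ\mapsto\nu$, $\mu_\prec\mapsto\nu^{\mathrm{op}}$, and there are morphisms of operads * $\varphi\colon\mathrm{DSu}(P)\to\mathrm{RB}(P)$ with $\omega_\prec\mapsto\omega\circ_2R$, $\omega_\succ\mapsto\omega\circ_1R$; * $\psi\colon\mathrm{RB}(P)\to P\otimes_{\mathrm H}\mathrm{RB}(\mathrm{Com})$ with $\omega\mapsto\omega\otimes\mu$, $R\mapsto\mathrm{id}\otimes R$; * $\chi\colon\mathrm{DSu}(P)\to P\otimes_{\mathrm H}\mathrm{Zinb}$ with $\omega_\prec\mapsto\omega\otimes\nu^{\mathrm{op}}$, $\omega_\succ\mapsto\omega\otimes\nu$; * $\zeta\colon\mathrm{Zinb}\to\mathrm{RB}(\mathrm{Com})$ with $\nu\mapsto\mu\circ_1R$, such that the square commutes: $(\mathrm{id}_P\otimes\zeta)\circ\chi=\psi\circ\varphi$. In particular the composite $\psi\circ\varphi\colon\mathrm{DSu}(P)\to\mathrm{RB}(P)\to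 P\otimes_{\mathrm H}\mathrm{RB}(\mathrm{Com})$ factors through $P\otimes_{\mathrm H}\mathrm{Zinb}$. Moreover, for every $P$-algebra $A$ and every commutative Rota–Baxter algebra $B$ (an $\mathrm{RB}(\mathrm{Com})$-algebra), there is exactly one $\mathrm{DSu}(P)$-algebra structure on $A\otimes B$ in which each $x\in\mathrm{DSu}(P)(n)$ acts on $(a_1\otimes b_1,\dots,a_n\otimes b_n)$ through $\psi(\varphi(x))\in P(n)\otimes\mathrm{RB}(\mathrm{Com})(n)$, where $p\otimes q$ acts by $p(a_1,\dots,a_n)\otimes q(b_1,\dots,b_n)$. It satisfies $$\omega_\prec(a_1\otimes b_1,a_2\otimes b_2)=\omega(a_1,a_2)\otimes b_1R(b_2),\qquad \omega_\succ(a_1\otimes b_1,a_2\otimes b_2)=\omega(a_1,a_2)\otimes R(b_1)b_2$$ for all $\omega\in V$. -/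

import Mathlib

open scoped TensorProduct

namespace BinaryOperads

universe u v w w₁ w₂

/-! ## Bijections used to state the operad axioms -/

/-- `I ⊔ (J ⊔ {∗}) ≅ (I ⊔ J) ⊔ {∗}`. -/
def sumOption (I J : Type) : I ⊕ Option J ≃ Option (I ⊕ J) where
  toFun
    | .inl i => some (.inl i)
    | .inr none => none
    | .inr (some j) => some (.inr j)
  invFun
    | none => .inr none
    | some (.inl i) => .inl i
    | some (.inr j) => .inr (some j)
  left_inv x := by rcases x with i | (_ | j) <;> rfl
  right_inv x := by rcases x with _ | (i | j) <;> rfl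

/-- `(I ⊔ {∗}) ⊔ J ≅ (I ⊔ J) ⊔ {∗}`. -/
def optionSum (I J : Type) : Option I ⊕ J ≃ Option (I ⊕ J) where
  toFun
    | .inl none => none
    | .inl (some i) => some (.inl i)
    | .inr j => some (.inr j)
  invFun
    | none => .inl none
    | some (.inl i) => .inl (some i)
    | some (.inr j) => .inr j
  left_inv x := by rcases x with (_ | i) | j <;> rfl
  right_inv x := by rcases x with _ | (i | j) <;> rfl

/-- The exchange of the two distinguished points of `I ⊔ {∗} ⊔ {∗}`. -/
def optionSwap (I : Type) : Option (Option I) ≃ Option (Option I) where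
  toFun
    | none => some none
    | some none => none
    | some (some i) => some (some i)
  invFun
    | none => some none
    | some none => none
    | some (some i) => some (some i)
  left_inv x := by rcases x with _ | (_ | i) <;> rfl
  right_inv x := by rcases x with _ | (_ | i) <;> rfl

/-- `(I ⊔ J) ⊔ K ≅ (I ⊔ K) ⊔ J`. -/
def sumRightComm (I J K : Type) : (I ⊕ J) ⊕ K ≃ (I ⊕ K) ⊕ J where
  toFun
    | .inl (.inl i) => .inl (.inl i)
    | .inl (.inr j) => .inr j
    | .inr k => .inl (.inr k)
  invFun
    | .inl (.inl i) => .inl (.inl i)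
    | .inr j => .inl (.inr j)
    | .inl (.inr k) => .inr k
  left_inv x := by rcases x with (i | j) | k <;> rfl
  right_inv x := by rcases x with (i | j) | k <;> rfl

/-- `{∗} ≅ ∅ ⊔ {∗}`. -/
def unitOption : Unit ≃ Option Empty where
  toFun _ := none
  invFun _ := ()
  left_inv _ := rfl
  right_inv x := by rcases x with _ | x <;> [rfl; exact x.elim]

/-- `I ⊔ {∗} ≅ Option I`. -/
def sumUnit (I : Type) : I ⊕ Unit ≃ Option I where
  toFun
    | .inl i => some i
    | .inr _ => none
  invFun
    | none => .inr ()
    | some i => .inl i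
  left_inv x := by rcases x with i | _ <;> rfl
  right_inv x := by rcases x with _ | i <;> rfl

/-! ## Symmetric operads -/

/-- A symmetric `k`-linear operad, as a linear species (a functor from finite sets and bijections
to `k`-modules) with partial compositions.  A finite set with a chosen point `∗` is written
`Option I`, and `comp p q` is the partial composition `p ∘_∗ q`, that is, `q` is inserted in the
input `∗ = none` of `p`.  (Any other input is reached by transport along a bijection.) -/
structure Operad (k : Type u) [CommRing k] where
  obj : (I : Type) → [Finite I] → Type w
  [addCommGroup : ∀ (I : Type) [Finite I], AddCommGroup (obj I)]
  [module : ∀ (I : Type) [Finite I], Module k (obj I)]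
  map : ∀ {I J : Type} [Finite I] [Finite J], (I ≃ J) → (obj I →ₗ[k] obj J)
  one : obj Unit
  comp : ∀ {I J : Type} [Finite I] [Finite J], obj (Option I) →ₗ[k] obj J →ₗ[k] obj (I ⊕ J)
  map_refl : ∀ {I : Type} [Finite I] (p : obj I), map (Equiv.refl I) p = p
  map_trans : ∀ {I J K : Type} [Finite I] [Finite J] [Finite K] (e : I ≃ J) (f : J ≃ K)
    (p : obj I), map (e.trans f) p = map f (map e p)
  map_comp : ∀ {I I' J J' : Type} [Finite I] [Finite I'] [Finite J] [Finite J']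
    (e : I ≃ I') (f : J ≃ J') (p : obj (Option I)) (q : obj J),
    map (Equiv.sumCongr e f) (comp p q) = comp (map (Equiv.optionCongr e) p) (map f q)
  one_comp : ∀ {J : Type} [Finite J] (q : obj J),
    map (Equiv.emptySum Empty J) (comp (map unitOption one) q) = q
  comp_one : ∀ {I : Type} [Finite I] (p : obj (Option I)),
    map (sumUnit I) (comp p one) = p
  /-- sequential composition axiom -/
  assoc : ∀ {I J K : Type} [Finite I] [Finite J] [Finite K]
    (p : obj (Option I)) (q : obj (Option J)) (r : obj K),
    map (Equiv.sumAssoc I J K) (comp (map (sumOption I J) (comp p q)) r) = comp p (comp q r)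
  /-- parallel composition axiom -/
  parallel : ∀ {I J K : Type} [Finite I] [Finite J] [Finite K]
    (p : obj (Option (Option I))) (q : obj J) (r : obj K),
    map (sumRightComm I J K) (comp (map (optionSum I J) (comp p q)) r) =
      comp (map (optionSum I K) (comp (map (optionSwap I) p) r)) q

attribute [instance] Operad.addCommGroup Operad.module

namespace Operad

variable {k : Type u} [CommRing k]

/-- Morphisms of operads. -/
structure Hom (P : Operad.{u, w₁} k) (Q : Operad.{u, w₂} k) where
  app : ∀ (I : Type) [Finite I], P.obj I →ₗ[k] Q.obj I
  app_map : ∀ {I J : Type} [Finite I] [Finite J] (e : I ≃ J) (p : P.obj I),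
    app J (P.map e p) = Q.map e (app I p)
  app_one : app Unit P.one = Q.one
  app_comp : ∀ {I J : Type} [Finite I] [Finite J] (p : P.obj (Option I)) (q : P.obj J),
    app (I ⊕ J) (P.comp p q) = Q.comp (app (Option I) p) (app J q)

/-- The composite `P → Q → R`. -/
def Hom.comp {P : Operad.{u, w} k} {Q : Operad.{u, w₁} k} {R : Operad.{u, w₂} k}
    (g : Hom Q R) (f : Hom P Q) : Hom P R where
  app I _ := g.app I ∘ₗ f.app I
  app_map e p := by simp [f.app_map, g.app_map]
  app_one := by simp [f.app_one, g.app_one]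
  app_comp p q := by simp [f.app_comp, g.app_comp]

/-- A morphism of operads is an isomorphism when all its components are bijective. -/
def Hom.IsIso {P : Operad.{u, w₁} k} {Q : Operad.{u, w₂} k} (f : Hom P Q) : Prop :=
  ∀ (I : Type) [Finite I], Function.Bijective (f.app I)

/-- The Hadamard product `P ⊗_H Q`, with components `P(I) ⊗ Q(I)`. -/
noncomputable def hadamard (P : Operad.{u, w₁} k) (Q : Operad.{u, w₂} k) :
    Operad.{u, max w₁ w₂} k where
  obj I _ := P.obj I ⊗[k] Q.obj I
  map e := TensorProduct.map (P.map e) (Q.map e)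
  one := P.one ⊗ₜ Q.one
  comp := TensorProduct.map₂ P.comp Q.comp
  map_refl x := by
    induction x with
    | zero => simp
    | tmul p q => simp [P.map_refl, Q.map_refl]
    | add x y hx hy => rw [map_add, hx, hy]
  map_trans e f x := by
    induction x with
    | zero => simp
    | tmul p q => simp [P.map_trans, Q.map_trans]
    | add x y hx hy => simp only [map_add, hx, hy]
  map_comp e f x y := by
    induction x with
    | zero => simp
    | add x x' hx hx' => simp only [map_add, LinearMap.add_apply, hx, hx']
    | tmul p q =>
      induction y with
      | zero => simp
      | add y y' hy hy' => simp only [map_add, hy, hy']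
      | tmul p' q' => simp [P.map_comp, Q.map_comp]
  one_comp y := by
    induction y with
    | zero => simp
    | add y y' hy hy' => simp only [map_add, hy, hy']
    | tmul p' q' => simp [P.one_comp, Q.one_comp]
  comp_one x := by
    induction x with
    | zero => simp
    | add x x' hx hx' => simp only [map_add, LinearMap.add_apply, hx, hx']
    | tmul p q => simp [P.comp_one, Q.comp_one]
  assoc x y z := by
    induction x with
    | zero => simp
    | add x x' hx hx' => simp only [map_add, LinearMap.add_apply, hx, hx']
    | tmul p q =>
      induction y with
      | zero => simp
      | add y y' hy hy' => simp only [map_add, LinearMap.add_apply, hy, hy']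
      | tmul p' q' =>
        induction z with
        | zero => simp
        | add z z' hz hz' => simp only [map_add, hz, hz']
        | tmul p'' q'' => simp [P.assoc, Q.assoc]
  parallel x y z := by
    induction x with
    | zero => simp
    | add x x' hx hx' => simp only [map_add, LinearMap.add_apply, hx, hx']
    | tmul p q =>
      induction y with
      | zero => simp
      | add y y' hy hy' => simp only [map_add, LinearMap.add_apply, hy, hy']
      | tmul p' q' =>
        induction z with
        | zero => simp
        | add z z' hz hz' => simp only [map_add, LinearMap.add_apply, hz, hz']
        | tmul p'' q'' => simp [P.parallel, Q.parallel]

/-- The morphism `id ⊗ f : P ⊗_H Q → P ⊗_H R` induced by `f : Q → R`. -/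
noncomputable def hadamardMap (P : Operad.{u, w} k) {Q : Operad.{u, w₁} k}
    {R : Operad.{u, w₂} k} (f : Hom Q R) : Hom (hadamard P Q) (hadamard P R) where
  app I _ := TensorProduct.map LinearMap.id (f.app I)
  app_map {I J} _ _ e x := by
    change P.obj I ⊗[k] Q.obj I at x
    change TensorProduct.map _ _ (TensorProduct.map _ _ x) =
      TensorProduct.map _ _ (TensorProduct.map _ _ x)
    induction x using TensorProduct.induction_on with
    | zero => simp
    | add x x' hx hx' => simp only [map_add, hx, hx']
    | tmul p q => simp [f.app_map]
  app_one := by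
    change TensorProduct.map _ _ (P.one ⊗ₜ Q.one) = P.one ⊗ₜ R.one
    simp [f.app_one]
  app_comp {I J} _ _ x y := by
    change P.obj (Option I) ⊗[k] Q.obj (Option I) at x
    change P.obj J ⊗[k] Q.obj J at y
    change TensorProduct.map _ _ (TensorProduct.map₂ _ _ x y) =
      TensorProduct.map₂ _ _ (TensorProduct.map _ _ x) (TensorProduct.map _ _ y)
    induction x with
    | zero => simp
    | add x x' hx hx' => simp only [map_add, LinearMap.add_apply, hx, hx']
    | tmul p q =>
      induction y with
      | zero => simp
      | add y y' hy hy' => simp only [map_add, hy, hy']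
      | tmul p' q' => simp [f.app_comp]

/-- A `P`-algebra structure on the `k`-module `A`: every element of `P(I)` acts as a multilinear
operation with inputs indexed by `I`, compatibly with relabelling, unit and composition. -/
structure Algebra (P : Operad.{u, w} k) (A : Type v) [AddCommGroup A] [Module k A] where
  act : ∀ {I : Type} [Finite I], P.obj I →ₗ[k] MultilinearMap k (fun _ : I => A) A
  act_map : ∀ {I J : Type} [Finite I] [Finite J] (e : I ≃ J) (p : P.obj I) (a : J → A),
    act (P.map e p) a = act p (fun i => a (e i))
  act_one : ∀ a : Unit → A, act P.one a = a ()
  act_comp : ∀ {I J : Type} [Finite I] [Finite J] (p : P.obj (Option I)) (q : P.obj J)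
    (a : I ⊕ J → A),
    act (P.comp p q) a =
      act p (fun o => o.elim (act q (fun j => a (.inr j))) (fun i => a (.inl i)))

/-- The linear map `P(I) → A`, `p ↦ p(a)`, for fixed inputs `a`. -/
def Algebra.eval {P : Operad.{u, w} k} {A : Type v} [AddCommGroup A] [Module k A]
    (𝒜 : P.Algebra A) {I : Type} [Finite I] (a : I → A) : P.obj I →ₗ[k] A where
  toFun p := 𝒜.act p a
  map_add' p q := by simp
  map_smul' c p := by simp

/-- Operadic ideals. -/
structure Ideal (P : Operad.{u, w} k) where
  carrier : ∀ (I : Type) [Finite I], Submodule k (P.obj I)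
  map_mem : ∀ {I J : Type} [Finite I] [Finite J] (e : I ≃ J) {x : P.obj I},
    x ∈ carrier I → P.map e x ∈ carrier J
  comp_left_mem : ∀ {I J : Type} [Finite I] [Finite J] {x : P.obj (Option I)} (y : P.obj J),
    x ∈ carrier (Option I) → P.comp x y ∈ carrier (I ⊕ J)
  comp_right_mem : ∀ {I J : Type} [Finite I] [Finite J] (x : P.obj (Option I)) {y : P.obj J},
    y ∈ carrier J → P.comp x y ∈ carrier (I ⊕ J)

/-- Membership in the operadic ideal generated by a family of elements of the components
`P(n) = P({1, …, n})`. -/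
inductive InSpan (P : Operad.{u, w} k) (S : ∀ n : ℕ, Set (P.obj (Fin n))) :
    ∀ (I : Type) [Finite I], P.obj I → Prop
  | rel {n : ℕ} {x : P.obj (Fin n)} (hx : x ∈ S n) : InSpan P S (Fin n) x
  | zero {I : Type} [Finite I] : InSpan P S I 0
  | add {I : Type} [Finite I] {x y : P.obj I} (hx : InSpan P S I x) (hy : InSpan P S I y) :
      InSpan P S I (x + y)
  | smul {I : Type} [Finite I] (c : k) {x : P.obj I} (hx : InSpan P S I x) :
      InSpan P S I (c • x)
  | map {I J : Type} [Finite I] [Finite J] (e : I ≃ J) {x : P.obj I} (hx : InSpan P S I x) :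
      InSpan P S J (P.map e x)
  | compLeft {I J : Type} [Finite I] [Finite J] {x : P.obj (Option I)} (y : P.obj J)
      (hx : InSpan P S (Option I) x) : InSpan P S (I ⊕ J) (P.comp x y)
  | compRight {I J : Type} [Finite I] [Finite J] (x : P.obj (Option I)) {y : P.obj J}
      (hy : InSpan P S J y) : InSpan P S (I ⊕ J) (P.comp x y)

/-- The operadic ideal generated by a family of elements. -/
def span (P : Operad.{u, w} k) (S : ∀ n : ℕ, Set (P.obj (Fin n))) : P.Ideal where
  carrier I _ :=
    { carrier := {x | InSpan P S I x}
      zero_mem' := .zero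
      add_mem' := .add
      smul_mem' := fun c _ hx => .smul c hx }
  map_mem e _ hx := .map e hx
  comp_left_mem y hx := .compLeft y hx
  comp_right_mem x _ hy := .compRight x hy

/-- The quotient of an operad by an operadic ideal. -/
def quotient (P : Operad.{u, w} k) (N : P.Ideal) : Operad.{u, w} k where
  obj I _ := P.obj I ⧸ N.carrier I
  map {I J} _ _ e := Submodule.mapQ (N.carrier I) (N.carrier J) (P.map e) fun _ hx => N.map_mem e hx
  one := Submodule.Quotient.mk P.one
  comp {I J} _ _ := Submodule.liftQ (N.carrier (Option I))
    { toFun := fun p => Submodule.mapQ (N.carrier J) (N.carrier (I ⊕ J)) (P.comp p)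
        fun _ hy => N.comp_right_mem p hy
      map_add' := fun p p' => by ext; simp
      map_smul' := fun c p => by ext; simp }
    (fun p hp => by
      ext y
      simpa using N.comp_left_mem y hp)
  map_refl := by
    rintro I _ ⟨p⟩
    exact congrArg Submodule.Quotient.mk (P.map_refl p)
  map_trans := by
    rintro I J K _ _ _ e f ⟨p⟩
    exact congrArg Submodule.Quotient.mk (P.map_trans e f p)
  map_comp := by
    rintro I I' J J' _ _ _ _ e f ⟨p⟩ ⟨q⟩
    exact congrArg Submodule.Quotient.mk (P.map_comp e f p q)
  one_comp := by
    rintro J _ ⟨q⟩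
    exact congrArg Submodule.Quotient.mk (P.one_comp q)
  comp_one := by
    rintro I _ ⟨p⟩
    exact congrArg Submodule.Quotient.mk (P.comp_one p)
  assoc := by
    rintro I J K _ _ _ ⟨p⟩ ⟨q⟩ ⟨r⟩
    exact congrArg Submodule.Quotient.mk (P.assoc p q r)
  parallel := by
    rintro I J K _ _ _ ⟨p⟩ ⟨q⟩ ⟨r⟩
    exact congrArg Submodule.Quotient.mk (P.parallel p q r)

end Operad

/-! ## Trees and free operads -/

/-- Rooted planar trees with leaves labelled by `I`, unary vertices labelled by `U` and binary
vertices labelled by `V` (equivalently, formal expressions in variables from `I`). -/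
inductive OpTree (U : Type) (V : Type w) (I : Type) : Type w
  | leaf (i : I) : OpTree U V I
  | un (a : U) (t : OpTree U V I) : OpTree U V I
  | bin (ω : V) (l r : OpTree U V I) : OpTree U V I

namespace OpTree

variable {U : Type} {V : Type w} {I J K : Type}

/-- The leaf labels of a tree, from left to right. -/
def leaves : OpTree U V I → List I
  | leaf i => [i]
  | un _ t => t.leaves
  | bin _ l r => l.leaves ++ r.leaves

/-- Every label occurs at exactly one leaf. -/
def IsLinear (t : OpTree U V I) : Prop :=
  t.leaves.Nodup ∧ ∀ i, i ∈ t.leaves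

/-- Simultaneous grafting of trees at the leaves. -/
def bind (f : I → OpTree U V J) : OpTree U V I → OpTree U V J
  | leaf i => f i
  | un a t => un a (t.bind f)
  | bin ω l r => bin ω (l.bind f) (r.bind f)

/-- Relabelling of the leaves. -/
def map (f : I → J) : OpTree U V I → OpTree U V J :=
  bind fun i => leaf (f i)

/-- Grafting of `s` at the leaf `none` of `t`. -/
def graft (t : OpTree U V (Option I)) (s : OpTree U V J) : OpTree U V (I ⊕ J) :=
  t.bind fun o => o.elim (s.map Sum.inr) (fun i => leaf (.inl i))

theorem leaves_bind (f : I → OpTree U V J) (t : OpTree U V I) :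
    (t.bind f).leaves = t.leaves.flatMap fun i => (f i).leaves := by
  induction t with
  | leaf i => simp [bind, leaves]
  | un a t ih => simpa [bind, leaves] using ih
  | bin ω l r hl hr => simp [bind, leaves, hl, hr]

theorem leaves_map (f : I → J) (t : OpTree U V I) : (t.map f).leaves = t.leaves.map f := by
  simp [map, leaves_bind, leaves]
  induction t.leaves with
  | nil => rfl
  | cons a l ih => simp [ih]

theorem bind_bind (f : I → OpTree U V J) (g : J → OpTree U V K) (t : OpTree U V I) :
    (t.bind f).bind g = t.bind fun i => (f i).bind g := by
  induction t with
  | leaf i => rfl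
  | un a t ih => simp [bind, ih]
  | bin ω l r hl hr => simp [bind, hl, hr]

theorem bind_leaf (t : OpTree U V I) : t.bind leaf = t := by
  induction t with
  | leaf i => rfl
  | un a t ih => simp [bind, ih]
  | bin ω l r hl hr => simp [bind, hl, hr]

theorem IsLinear.map {t : OpTree U V I} (ht : t.IsLinear) (e : I ≃ J) :
    (t.map e).IsLinear := by
  constructor
  · rw [leaves_map]; exact ht.1.map e.injective
  · intro j
    rw [leaves_map]
    exact List.mem_map.2 ⟨e.symm j, ht.2 _, by simp⟩

theorem IsLinear.graft {t : OpTree U V (Option I)} {s : OpTree U V J} (ht : t.IsLinear)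
    (hs : s.IsLinear) : (t.graft s).IsLinear := by
  constructor
  · rw [OpTree.graft, leaves_bind, List.nodup_flatMap]
    refine ⟨?_, ht.1.imp ?_⟩
    · rintro (_ | i) -
      · simpa [leaves_map] using hs.1.map Sum.inr_injective
      · simp [leaves]
    · rintro (_ | i) (_ | i') h
      · exact absurd rfl h
      · simp [Function.onFun, leaves_map, leaves]
      · simp [Function.onFun, leaves_map, leaves]
      · have : i' ≠ i := fun e => h (by rw [e])
        simpa [Function.onFun, leaves] using this
  · rintro (i | j)
    · rw [OpTree.graft, leaves_bind, List.mem_flatMap]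
      exact ⟨some i, ht.2 _, by simp [leaves]⟩
    · rw [OpTree.graft, leaves_bind, List.mem_flatMap]
      exact ⟨none, ht.2 _, by simpa [leaves_map] using hs.2 j⟩

end OpTree

/-- Trees whose leaves are in bijection with `I`. -/
abbrev LinTree (U : Type) (V : Type w) (I : Type) : Type w :=
  {t : OpTree U V I // t.IsLinear}

namespace LinTree

variable {U : Type} {V : Type w} {I J K : Type}

def map (e : I ≃ J) (t : LinTree U V I) : LinTree U V J :=
  ⟨t.1.map e, t.2.map e⟩

def graft (t : LinTree U V (Option I)) (s : LinTree U V J) : LinTree U V (I ⊕ J) :=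
  ⟨t.1.graft s.1, t.2.graft s.2⟩

end LinTree

section Free

variable (k : Type u) [CommRing k]

open OpTree in
/-- The free operad on sets `U` of unary and `V` of binary operations (with free action of the
symmetric group): its component on `I` is spanned by the trees with leaves in bijection with `I`,
and composition is grafting. -/
noncomputable def freeOperad (U : Type) (V : Type w) : Operad.{u, max u w} k where
  obj I _ := LinTree U V I →₀ k
  map e := Finsupp.lmapDomain k k (LinTree.map e)
  one := Finsupp.single ⟨.leaf (), by simp [IsLinear, leaves]⟩ 1
  comp := Finsupp.linearCombination k fun t => Finsupp.lmapDomain k k (LinTree.graft t)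
  map_refl {I} _ p := by
    have : LinTree.map (U := U) (V := V) (Equiv.refl I) = id := by
      funext t; exact Subtype.ext (bind_leaf t.1)
    simp [this]
  map_trans e f p := by
    rw [Finsupp.lmapDomain_apply, Finsupp.lmapDomain_apply, Finsupp.lmapDomain_apply,
      ← Finsupp.mapDomain_comp]
    congr 1
    funext t
    exact Subtype.ext (bind_bind (fun i => leaf (e i)) (fun i => leaf (f i)) t.1).symm
  map_comp e f p q := by
    induction p using Finsupp.induction_linear with
    | zero => simp
    | add p p' hp hp' => simp only [map_add, LinearMap.add_apply, hp, hp']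
    | single t c =>
      induction q using Finsupp.induction_linear with
      | zero => simp
      | add q q' hq hq' => simp only [map_add, hq, hq']
      | single s d =>
        simp only [Finsupp.lmapDomain_apply, Finsupp.mapDomain_single,
          Finsupp.linearCombination_single, LinearMap.smul_apply, Finsupp.smul_single]
        congr 1
        apply Subtype.ext
        simp only [LinTree.map, LinTree.graft, OpTree.map, OpTree.graft, bind_bind]
        congr 1
        funext o
        rcases o with _ | i <;> simp [OpTree.bind, bind_bind]
  one_comp q := by
    induction q using Finsupp.induction_linear with
    | zero => simp
    | add q q' hq hq' => simp only [map_add, hq, hq']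
    | single s d =>
      simp only [Finsupp.lmapDomain_apply, Finsupp.mapDomain_single,
        Finsupp.linearCombination_single, one_smul]
      congr 1
      apply Subtype.ext
      simp only [LinTree.map, LinTree.graft, OpTree.map, OpTree.graft, OpTree.bind, unitOption,
        Equiv.coe_fn_mk, Option.elim, bind_bind]
      exact bind_leaf _
  comp_one p := by
    induction p using Finsupp.induction_linear with
    | zero => simp
    | add p p' hp hp' => simp only [map_add, LinearMap.add_apply, hp, hp']
    | single t c =>
      simp only [Finsupp.lmapDomain_apply, Finsupp.mapDomain_single,
        Finsupp.linearCombination_single, LinearMap.smul_apply, Finsupp.smul_single,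
        smul_eq_mul, mul_one]
      congr 1
      apply Subtype.ext
      simp only [LinTree.map, LinTree.graft, OpTree.map, OpTree.graft, bind_bind]
      conv_rhs => rw [← bind_leaf t.1]
      congr 1
      funext o
      rcases o with _ | i <;> simp [OpTree.bind, sumUnit]
  assoc p q r := by
    induction p using Finsupp.induction_linear with
    | zero => simp
    | add p p' hp hp' => simp only [map_add, LinearMap.add_apply, hp, hp']
    | single t c =>
      induction q using Finsupp.induction_linear with
      | zero => simp
      | add q q' hq hq' => simp only [map_add, LinearMap.add_apply, hq, hq']
      | single s d =>
        induction r using Finsupp.induction_linear with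
        | zero => simp
        | add r r' hr hr' => simp only [map_add, hr, hr']
        | single m b =>
          simp only [Finsupp.lmapDomain_apply, Finsupp.mapDomain_single,
            Finsupp.linearCombination_single, LinearMap.smul_apply, Finsupp.smul_single,
            smul_eq_mul, mul_assoc]
          congr 1
          apply Subtype.ext
          simp only [LinTree.map, LinTree.graft, OpTree.map, OpTree.graft, bind_bind]
          congr 1
          funext o
          rcases o with _ | i
          · simp only [OpTree.bind, Option.elim, bind_bind]
            congr 1
            funext o
            rcases o with _ | i <;> simp [OpTree.bind, sumOption, bind_bind]
          · simp [OpTree.bind, sumOption]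
  parallel p q r := by
    induction p using Finsupp.induction_linear with
    | zero => simp
    | add p p' hp hp' => simp only [map_add, LinearMap.add_apply, hp, hp']
    | single t c =>
      induction q using Finsupp.induction_linear with
      | zero => simp
      | add q q' hq hq' => simp only [map_add, LinearMap.add_apply, hq, hq']
      | single s d =>
        induction r using Finsupp.induction_linear with
        | zero => simp
        | add r r' hr hr' => simp only [map_add, LinearMap.add_apply, hr, hr']
        | single m b =>
          simp only [Finsupp.lmapDomain_apply, Finsupp.mapDomain_single,
            Finsupp.linearCombination_single, LinearMap.smul_apply, Finsupp.smul_single,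
            smul_eq_mul]
          have h : c * d * b = c * b * d := by ring
          rw [h]
          congr 1
          apply Subtype.ext
          simp only [LinTree.map, LinTree.graft, OpTree.map, OpTree.graft, bind_bind]
          congr 1
          funext o
          rcases o with _ | (_ | i) <;>
            simp [OpTree.bind, optionSum, optionSwap, sumRightComm, bind_bind]

variable {k}

/-- Families of relations among the elements of a free operad (elements of the components
`{1, …, n}`). -/
abbrev Relations (k : Type u) [CommRing k] (U : Type) (V : Type w) :=
  ∀ n : ℕ, Set ((freeOperad k U V).obj (Fin n))

/-- The operad presented by generators `U` (unary) and `V` (binary) and relations `S`. -/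
noncomputable def presented {U : Type} {V : Type w} (S : Relations k U V) :
    Operad.{u, max u w} k :=
  (freeOperad k U V).quotient ((freeOperad k U V).span S)

/-- The tree `t` as an element of the free operad. -/
noncomputable def mono {U : Type} {V : Type w} {I : Type} [Finite I] (t : OpTree U V I)
    (h : t.IsLinear := by
      simp [OpTree.IsLinear, OpTree.leaves, Fin.forall_fin_succ, -forall_const]) :
    (freeOperad k U V).obj I :=
  Finsupp.single ⟨t, h⟩ 1

/-- The class of an element of the free operad in a presented operad. -/
noncomputable def cls {U : Type} {V : Type w} (S : Relations k U V) {I : Type} [Finite I]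
    (x : (freeOperad k U V).obj I) : (presented S).obj I :=
  Submodule.Quotient.mk x

/-- The operad `P`, with the elements `gen ω ∈ P(2)`, is presented by the binary generators
`V` and the relations `S`. -/
def IsPresentedBy (P : Operad.{u, w₁} k) {V : Type w} (gen : V → P.obj (Fin 2))
    (S : Relations k Empty V) : Prop :=
  ∃ e : Operad.Hom (presented S) P, e.IsIso ∧
    ∀ ω : V, e.app (Fin 2) (cls S (mono (.bin ω (.leaf 0) (.leaf 1)))) = gen ω

end Free

/-! ## Disuccessors -/

/-- The two halves `≺` and `≻` of a split operation. -/
inductive Side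
  | prec
  | succ

section Splitting

variable (k : Type u) [CommRing k] {V : Type w} {I : Type}

/-- The bilinear extension of `(l, r) ↦ c(l, r)` to formal linear combinations of trees. -/
noncomputable def binSum {V : Type w} (c : V) (x y : OpTree Empty V I →₀ k) :
    OpTree Empty V I →₀ k :=
  x.sum fun l m => y.sum fun r n => Finsupp.single (.bin c l r) (m * n)

/-- All vertices `ω` of the tree are replaced by `ω_⋆ = ω_≺ + ω_≻`. -/
noncomputable def splitAll : OpTree Empty V I → (OpTree Empty (V × Side) I →₀ k)
  | .leaf i => Finsupp.single (.leaf i) 1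
  | .un a _ => a.elim
  | .bin ω l r =>
      binSum k (ω, .prec) (splitAll l) (splitAll r) + binSum k (ω, .succ) (splitAll l) (splitAll r)

open Classical in
/-- The disuccessor of a tree with respect to the leaf `x`: a vertex `ω` on the path from the root
to `x` is replaced by `ω_≺` if the path turns left at this vertex and by `ω_≻` if it turns right;
a vertex `ω` that is not on the path is replaced by `ω_⋆ = ω_≺ + ω_≻`. -/
noncomputable def splitAt (x : I) : OpTree Empty V I → (OpTree Empty (V × Side) I →₀ k)
  | .leaf i => Finsupp.single (.leaf i) 1
  | .un a _ => a.elim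
  | .bin ω l r =>
      if x ∈ l.leaves then binSum k (ω, .prec) (splitAt x l) (splitAll k r)
      else binSum k (ω, .succ) (splitAll k l) (splitAt x r)

theorem leaves_binSum {c : V} {x y : OpTree Empty V I →₀ k} {L R : List I}
    (hx : ∀ s ∈ x.support, s.leaves = L) (hy : ∀ s ∈ y.support, s.leaves = R) :
    ∀ s ∈ (binSum k c x y).support, s.leaves = L ++ R := by
  classical
  intro s hs
  obtain ⟨l, hl, hs⟩ := Finset.mem_biUnion.1 (Finsupp.support_sum hs)
  obtain ⟨r, hr, hs⟩ := Finset.mem_biUnion.1 (Finsupp.support_sum hs)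
  rw [Finset.mem_singleton.1 (Finsupp.support_single_subset hs), OpTree.leaves, hx l hl, hy r hr]

theorem leaves_splitAll (t : OpTree Empty V I) :
    ∀ s ∈ (splitAll k t).support, s.leaves = t.leaves := by
  classical
  induction t with
  | leaf i =>
    intro s hs
    rw [Finset.mem_singleton.1 (Finsupp.support_single_subset hs), OpTree.leaves, OpTree.leaves]
  | un a t ih => exact a.elim
  | bin ω l r hl hr =>
    intro s hs
    rcases Finset.mem_union.1 (Finsupp.support_add hs) with hs | hs <;>
      exact leaves_binSum k hl hr s hs

/-- All trees occurring in `splitAt k x t` have the same leaves as `t`. -/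
theorem leaves_splitAt (x : I) (t : OpTree Empty V I) :
    ∀ s ∈ (splitAt k x t).support, s.leaves = t.leaves := by
  classical
  induction t with
  | leaf i =>
    intro s hs
    rw [Finset.mem_singleton.1 (Finsupp.support_single_subset hs), OpTree.leaves, OpTree.leaves]
  | un a t ih => exact a.elim
  | bin ω l r hl hr =>
    intro s hs
    rw [splitAt] at hs
    split_ifs at hs
    · exact leaves_binSum k hl (leaves_splitAll k r) s hs
    · exact leaves_binSum k (leaves_splitAll k l) hr s hs

/-- The disuccessor with respect to the leaf `x`, extended linearly to the free operad.  (By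
`leaves_splitAt`, the restriction to trees with leaves in bijection with `I` loses nothing.) -/
noncomputable def su [Finite I] (x : I) :
    (freeOperad k Empty V).obj I →ₗ[k] (freeOperad k Empty (V × Side)).obj I :=
  Finsupp.linearCombination k fun t : LinTree Empty V I =>
    Finsupp.subtypeDomain OpTree.IsLinear (splitAt k x t.1)

end Splitting

section Constructions

variable {k : Type u} [CommRing k] {V : Type w}

/-- The relations of the disuccessor: the disuccessors of all given relations with respect to
all leaves. -/
def DSuRel (S : Relations k Empty V) : Relations k Empty (V × Side) :=
  fun n => {y | ∃ r ∈ S n, ∃ x : Fin n, y = su k x r}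

/-- The disuccessor `DSu(P)` of the operad `P` with binary generators `V` and relations `S`. -/
noncomputable abbrev DSu (S : Relations k Empty V) : Operad.{u, max u w} k :=
  presented (DSuRel S)

/-! ## Rota–Baxter operators -/

/-- A tree with binary vertices, as a tree with possible unary vertices. -/
def OpTree.incl {I : Type} : OpTree Empty V I → OpTree Unit V I
  | .leaf i => .leaf i
  | .un a _ => a.elim
  | .bin ω l r => .bin ω l.incl r.incl

theorem OpTree.leaves_incl {I : Type} (t : OpTree Empty V I) : t.incl.leaves = t.leaves := by
  induction t with
  | leaf i => rfl
  | un a t ih => exact a.elim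
  | bin ω l r hl hr => simp [incl, leaves, hl, hr]

/-- The inclusion of the free operad on `V` into the free operad on `V` and a unary operation. -/
noncomputable def inclFree {I : Type} [Finite I] :
    (freeOperad k Empty V).obj I →ₗ[k] (freeOperad k Unit V).obj I :=
  Finsupp.lmapDomain k k fun t : LinTree Empty V I =>
    (⟨t.1.incl, by rw [OpTree.IsLinear, OpTree.leaves_incl]; exact t.2⟩ : LinTree Unit V I)

/-- The Rota–Baxter operator, as an operation on trees. -/
abbrev rb {I : Type} (t : OpTree Unit V I) : OpTree Unit V I :=
  .un () t

/-- The defining relations of `P`-algebras with a Rota–Baxter operator `R`: those of `P`, and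
`ω(R(a₁), R(a₂)) = R(ω(R(a₁), a₂) + ω(a₁, R(a₂)))` for all generators `ω`. -/
inductive RBRel (S : Relations k Empty V) : Relations k Unit V
  | base {n : ℕ} {r : (freeOperad k Empty V).obj (Fin n)} (hr : r ∈ S n) : RBRel S n (inclFree r)
  | rotaBaxter (ω : V) : RBRel S 2
      (mono (.bin ω (rb (.leaf 0)) (rb (.leaf 1))) -
        (mono (rb (.bin ω (rb (.leaf 0)) (.leaf 1))) +
          mono (rb (.bin ω (.leaf 0) (rb (.leaf 1))))))

/-- The operad `RB(P)` of `P`-algebras with a Rota–Baxter operator, where `P` has binary generators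
`V` and relations `S`. -/
noncomputable abbrev RB (S : Relations k Empty V) : Operad.{u, max u w} k :=
  presented (RBRel S)

/-! ## Commutative associative algebras and Zinbiel algebras -/

variable (k)

/-- Relations of a commutative associative product `μ`. -/
inductive ComRel : Relations k Empty Unit
  | comm : ComRel 2 (mono (.bin () (.leaf 0) (.leaf 1)) - mono (.bin () (.leaf 1) (.leaf 0)))
  | assoc : ComRel 3
      (mono (.bin () (.bin () (.leaf 0) (.leaf 1)) (.leaf 2)) -
        mono (.bin () (.leaf 0) (.bin () (.leaf 1) (.leaf 2))))

/-- The Zinbiel identity `ν(a₁, ν(a₂, a₃)) = ν(ν(a₁, a₂), a₃) + ν(ν(a₂, a₁), a₃)`. -/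
inductive ZinbRel : Relations k Empty Unit
  | zinbiel : ZinbRel 3
      (mono (.bin () (.leaf 0) (.bin () (.leaf 1) (.leaf 2))) -
        (mono (.bin () (.bin () (.leaf 0) (.leaf 1)) (.leaf 2)) +
          mono (.bin () (.bin () (.leaf 1) (.leaf 0)) (.leaf 2))))

/-- The operad `RB(Com)` of commutative Rota–Baxter algebras. -/
noncomputable abbrev RBCom : Operad.{u, u} k :=
  RB (ComRel k)

/-- The operad of Zinbiel algebras. -/
noncomputable abbrev Zinb : Operad.{u, u} k :=
  presented (ZinbRel k)

end Constructions

/-! ## Names for the generating operations -/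

section Generators

variable {k : Type u} [CommRing k] {V : Type w}

namespace DSu

/-- `ω_≺ ∈ DSu(P)(2)`. -/
noncomputable def prec (S : Relations k Empty V) (ω : V) : (DSu S).obj (Fin 2) :=
  cls _ (mono (.bin (ω, Side.prec) (.leaf 0) (.leaf 1)))

/-- `ω_≻ ∈ DSu(P)(2)`. -/
noncomputable def succ (S : Relations k Empty V) (ω : V) : (DSu S).obj (Fin 2) :=
  cls _ (mono (.bin (ω, Side.succ) (.leaf 0) (.leaf 1)))

end DSu

namespace RB

/-- `ω(a₁, a₂)`. -/
noncomputable def gen (S : Relations k Empty V) (ω : V) : (RB S).obj (Fin 2) :=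
  cls _ (mono (.bin ω (.leaf 0) (.leaf 1)))

/-- `R(a)`. -/
noncomputable def R (S : Relations k Empty V) : (RB S).obj Unit :=
  cls _ (mono (rb (.leaf ())))

/-- `ω ∘₁ R = ω(R(a₁), a₂)`. -/
noncomputable def genR₁ (S : Relations k Empty V) (ω : V) : (RB S).obj (Fin 2) :=
  cls _ (mono (.bin ω (rb (.leaf 0)) (.leaf 1)))

/-- `ω ∘₂ R = ω(a₁, R(a₂))`. -/
noncomputable def genR₂ (S : Relations k Empty V) (ω : V) : (RB S).obj (Fin 2) :=
  cls _ (mono (.bin ω (.leaf 0) (rb (.leaf 1))))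

end RB

namespace Zinb

variable (k)

/-- `ν(a₁, a₂)`. -/
noncomputable def nu : (Zinb k).obj (Fin 2) :=
  cls _ (mono (.bin () (.leaf 0) (.leaf 1)))

/-- The opposite operation `ν(a₂, a₁)`. -/
noncomputable def nuOp : (Zinb k).obj (Fin 2) :=
  cls _ (mono (.bin () (.leaf 1) (.leaf 0)))

end Zinb

end Generators

end BinaryOperads

open BinaryOperads

/-!
All the morphisms are given on trees by substitution: `φ` replaces `ω_≺` by `ω(a₁, R(a₂))` and `ω_≻`
by `ω(R(a₁), a₂)`; `ψ` and `χ` send a tree `t` to `t' ⊗ t''`, where `t'` forgets `R` (respectively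
the sides) and `t''` replaces all `ω` by `μ` (respectively by `ν` or `ν^op`). So the work lies in
checking that relations go to zero, and this is done in algebras rather than in operads.

The transfer to algebras is a completeness theorem, `cls_eq_of_forall`: an element of the free operad
that vanishes in all modules with operations satisfying the relations `S` (`Interp.Satisfies`) is
zero in the operad presented by `S`. The modules to test are the free algebras `FreeModel S I`, built
from trees whose labels may be repeated. Since relations are multilinear, dropping the trees with
repeated or missing labels is compatible with them (`inSpan_linPart_bindFree`), so that the presented
operad is a retract of the free algebra. Retracts survive tensor products; hence elements of a
Hadamard product can be tested in tensor products of algebras (`hadamardPair_substHom_eq_zero`).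

In algebras, the statements are as follows.

* In an algebra with a Rota–Baxter operator, `R` applied to the full splitting `splitAll t` of a tree
  is `t(R a₁, …, R aₙ)`, and the disuccessor of `t` at the leaf `x` is `t(R a₁, …, a_x, …, R aₙ)`. So
  the disuccessor of a relation is a substitution instance of the relation, which gives `φ`.
* In a Zinbiel algebra, left multiplications commute, and the disuccessor of `t` at `x` is the
  product of the left multiplications by all `aᵢ` with `i ≠ x`, applied to `a_x`. It depends only on
  `x`, so that on `A ⊗ B` the disuccessor of a relation `r` at `x` acts as `r` on `A`, tensored with
  a fixed element of `B`. This gives `χ`, and `DSu(Com) → Zinb`. In the same way the value of a tree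
  in a commutative algebra depends only on its leaves, which gives `ψ`.

The square commutes because its two sides send a tree to `t ⊗ s` and `t ⊗ s'`, where `s` and `s'`
differ only by commutativity of `μ`. Finally, operations satisfying the relations make a module an
algebra over the presented operad (`Interp.toAlgebra`), and every algebra arises in this way
(`ofAlgebra_evalFree`), which gives the algebra structure on `A ⊗ B`; it is unique because pure
tensors span `A ⊗ B`.
-/

namespace BinaryOperads

universe u v w w₁ w₂ w₃

/-! ### The free operad and its basis of trees -/

section FreeOperad

variable {k : Type u} [CommRing k] {U : Type} {V : Type w} {I J : Type} [Finite I] [Finite J]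

/-- The linear map from a component of the free operad with given values on trees. -/
noncomputable def freeLin {A : Type v} [AddCommGroup A] [Module k A] (f : LinTree U V I → A) :
    (freeOperad k U V).obj I →ₗ[k] A :=
  Finsupp.linearCombination k f

theorem freeLin_mono {A : Type v} [AddCommGroup A] [Module k A] (f : LinTree U V I → A)
    (t : OpTree U V I) (h : t.IsLinear) : freeLin f (mono (k := k) t h) = f ⟨t, h⟩ :=
  (Finsupp.linearCombination_single k (1 : k) (⟨t, h⟩ : LinTree U V I)).trans (one_smul k _)

/-- The trees span the free operad. -/
@[elab_as_elim]
theorem freeOperad_induction {motive : (freeOperad k U V).obj I → Prop}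
    (zero : motive 0) (add : ∀ x y, motive x → motive y → motive (x + y))
    (smul_mono : ∀ (c : k) (t : OpTree U V I) (h : t.IsLinear), motive (c • mono t h))
    (x : (freeOperad k U V).obj I) : motive x := by
  change LinTree U V I →₀ k at x
  induction x using Finsupp.induction_linear with
  | zero => exact zero
  | add x y hx hy => exact add x y hx hy
  | single t c =>
    have h : c • (Finsupp.single t 1 : LinTree U V I →₀ k) = Finsupp.single t c := by simp
    exact h ▸ smul_mono c t.1 t.2

theorem freeOperad_hom_ext {A : Type v} [AddCommGroup A] [Module k A]
    {f g : (freeOperad k U V).obj I →ₗ[k] A}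
    (h : ∀ (t : OpTree U V I) (ht : t.IsLinear), f (mono t ht) = g (mono t ht)) : f = g := by
  ext x
  induction x using freeOperad_induction with
  | zero => rw [map_zero, map_zero]
  | add x y hx hy => rw [map_add, map_add, hx, hy]
  | smul_mono c t ht => rw [map_smul, map_smul, h]

theorem freeOperad_map_mono (e : I ≃ J) (t : OpTree U V I) (h : t.IsLinear) :
    (freeOperad k U V).map e (mono t h) = mono (t.map e) (h.map e) :=
  Finsupp.mapDomain_single

theorem freeOperad_comp_mono (t : OpTree U V (Option I)) (h : t.IsLinear) (s : OpTree U V J)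
    (hs : s.IsLinear) :
    (freeOperad k U V).comp (mono t h) (mono s hs) = mono (t.graft s) (h.graft hs) := by
  have : Finsupp.linearCombination k
      (fun t : LinTree U V (Option I) => Finsupp.lmapDomain k k (LinTree.graft (J := J) t))
      (Finsupp.single ⟨t, h⟩ 1) (Finsupp.single ⟨s, hs⟩ 1) =
      Finsupp.single ⟨t.graft s, h.graft hs⟩ 1 := by
    simp [LinTree.graft]
  exact this

theorem isLinear_leaf_unit : (OpTree.leaf () : OpTree U V Unit).IsLinear := by
  simp [OpTree.IsLinear, OpTree.leaves]

theorem freeOperad_one :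
    (freeOperad k U V).one = mono (.leaf ()) isLinear_leaf_unit := rfl

end FreeOperad

/-! ### Interpretations of trees in modules -/

/-- A `k`-module with linear operations indexed by `U` and bilinear operations indexed by `V`. -/
structure Interp (k : Type u) [CommRing k] (U : Type) (V : Type w) (A : Type v)
    [AddCommGroup A] [Module k A] where
  un : U → A →ₗ[k] A
  bin : V → A →ₗ[k] A →ₗ[k] A

namespace Interp

variable {k : Type u} [CommRing k] {U : Type} {V : Type w} {A : Type v} [AddCommGroup A]
  [Module k A] (M : Interp k U V A) {X Y : Type}

/-- The value of a tree, its leaves being read as elements of the module. -/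
def eval (a : X → A) : OpTree U V X → A
  | .leaf i => a i
  | .un c t => M.un c (eval a t)
  | .bin ω l r => M.bin ω (eval a l) (eval a r)

theorem eval_bind (f : X → OpTree U V Y) (a : Y → A) (t : OpTree U V X) :
    M.eval a (t.bind f) = M.eval (fun i => M.eval a (f i)) t := by
  induction t with
  | leaf i => rfl
  | un c t ih => simp [OpTree.bind, eval, ih]
  | bin ω l r hl hr => simp [OpTree.bind, eval, hl, hr]

theorem eval_congr {a b : X → A} (t : OpTree U V X) (h : ∀ i ∈ t.leaves, a i = b i) :
    M.eval a t = M.eval b t := by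
  induction t with
  | leaf i => exact h i (by simp [OpTree.leaves])
  | un c t ih => exact congrArg (M.un c) (ih h)
  | bin ω l r hl hr =>
    rw [eval, eval, hl fun i hi => h i (List.mem_append_left _ hi),
      hr fun i hi => h i (List.mem_append_right _ hi)]

theorem eval_update_of_notMem [DecidableEq X] (a : X → A) (t : OpTree U V X) {i : X}
    (hi : i ∉ t.leaves) (x : A) : M.eval (Function.update a i x) t = M.eval a t :=
  M.eval_congr t fun j hj => Function.update_of_ne (fun h => hi (by rwa [← h])) _ _

theorem eval_update_add [DecidableEq X] (a : X → A) (t : OpTree U V X) (ht : t.leaves.Nodup)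
    {i : X} (hi : i ∈ t.leaves) (x y : A) :
    M.eval (Function.update a i (x + y)) t =
      M.eval (Function.update a i x) t + M.eval (Function.update a i y) t := by
  induction t with
  | leaf j =>
    obtain rfl : i = j := by simpa [OpTree.leaves] using hi
    simp [eval]
  | un c t ih => simp [eval, ih ht hi]
  | bin ω l r hl hr =>
    obtain ⟨hdl, hdr, hd⟩ := List.nodup_append'.1 ht
    rcases List.mem_append.1 hi with h | h
    · have h' : i ∉ r.leaves := fun h' => hd h h'
      simp [eval, hl hdl h, M.eval_update_of_notMem a r h']
    · have h' : i ∉ l.leaves := fun h' => hd h' h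
      simp [eval, hr hdr h, M.eval_update_of_notMem a l h']

theorem eval_update_smul [DecidableEq X] (a : X → A) (t : OpTree U V X) (ht : t.leaves.Nodup)
    {i : X} (hi : i ∈ t.leaves) (c : k) (x : A) :
    M.eval (Function.update a i (c • x)) t = c • M.eval (Function.update a i x) t := by
  induction t with
  | leaf j =>
    obtain rfl : i = j := by simpa [OpTree.leaves] using hi
    simp [eval]
  | un c t ih => simp [eval, ih ht hi]
  | bin ω l r hl hr =>
    obtain ⟨hdl, hdr, hd⟩ := List.nodup_append'.1 ht
    rcases List.mem_append.1 hi with h | h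
    · have h' : i ∉ r.leaves := fun h' => hd h h'
      simp [eval, hl hdl h, M.eval_update_of_notMem a r h']
    · have h' : i ∉ l.leaves := fun h' => hd h' h
      simp [eval, hr hdr h, M.eval_update_of_notMem a l h']

/-- A tree with leaves in bijection with `X` acts as a multilinear operation. -/
def evalTree (t : LinTree U V X) : MultilinearMap k (fun _ : X => A) A where
  toFun a := M.eval a t.1
  map_update_add' a i x y := M.eval_update_add a t.1 t.2.1 (t.2.2 i) x y
  map_update_smul' a i c x := M.eval_update_smul a t.1 t.2.1 (t.2.2 i) c x

/-- The action of the free operad, in which every tree acts by its value. -/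
noncomputable def evalFree {I : Type} [Finite I] :
    (freeOperad k U V).obj I →ₗ[k] MultilinearMap k (fun _ : I => A) A :=
  freeLin M.evalTree

@[simp] theorem evalFree_mono {I : Type} [Finite I] (t : OpTree U V I) (h : t.IsLinear)
    (a : I → A) : M.evalFree (mono t h) a = M.eval a t := by
  rw [evalFree, freeLin_mono]; rfl

/-- The value of a linear combination of trees, not necessarily with distinct leaves. -/
noncomputable def evalSum (a : X → A) : (OpTree U V X →₀ k) →ₗ[k] A :=
  Finsupp.linearCombination k (M.eval a)

@[simp] theorem evalSum_single (a : X → A) (t : OpTree U V X) (c : k) :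
    M.evalSum a (Finsupp.single t c) = c • M.eval a t := by
  simp [evalSum]

theorem evalFree_subtypeDomain {I : Type} [Finite I] (z : OpTree U V I →₀ k)
    (hz : ∀ t ∈ z.support, t.IsLinear) (a : I → A) :
    M.evalFree (Finsupp.subtypeDomain OpTree.IsLinear z : LinTree U V I →₀ k) a =
      M.evalSum a z := by
  let ev : MultilinearMap k (fun _ : I => A) A →ₗ[k] A := ⟨⟨fun g => g a, fun _ _ => rfl⟩,
    fun _ _ => rfl⟩
  change ev (Finsupp.sum (Finsupp.subtypeDomain OpTree.IsLinear z) fun i c => c • M.evalTree i) = _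
  rw [map_finsuppSum]
  exact Finsupp.sum_subtypeDomain_index (h := fun i c => c • M.eval a i) hz

theorem evalFree_map {I J : Type} [Finite I] [Finite J] (e : I ≃ J)
    (z : (freeOperad k U V).obj I) (a : J → A) :
    M.evalFree ((freeOperad k U V).map e z) a = M.evalFree z (fun i => a (e i)) := by
  induction z using freeOperad_induction with
  | zero => simp
  | add z z' h h' => simp only [map_add, add_apply, h, h']
  | smul_mono c t ht =>
    simp only [map_smul, smul_apply, freeOperad_map_mono, evalFree_mono, OpTree.map, eval_bind]
    rfl

theorem eval_graft {I J : Type} (t : OpTree U V (Option I)) (s : OpTree U V J) (a : I ⊕ J → A) :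
    M.eval a (t.graft s) =
      M.eval (fun o => o.elim (M.eval (fun j => a (.inr j)) s) (fun i => a (.inl i))) t := by
  rw [OpTree.graft, eval_bind]
  congr 1
  funext o
  rcases o with _ | i
  · simp only [Option.elim, OpTree.map, eval_bind]; rfl
  · rfl

end Interp

section OptionElim

variable {k : Type u} [CommRing k] {A : Type v} [AddCommGroup A] [Module k A]

theorem option_elim_eq_update {I : Type} [DecidableEq (Option I)] (x : A) (a : I → A) :
    (fun o : Option I => o.elim x a) = Function.update (fun o : Option I => o.elim 0 a) none x := by
  funext o
  rcases o with _ | i <;> simp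

theorem multilinear_option_elim_add {I : Type}
    (f : MultilinearMap k (fun _ : Option I => A) A) (x y : A) (a : I → A) :
    f (fun o => o.elim (x + y) a) = f (fun o => o.elim x a) + f (fun o => o.elim y a) := by
  classical
  rw [option_elim_eq_update (x + y), option_elim_eq_update x, option_elim_eq_update y,
    f.map_update_add]

theorem multilinear_option_elim_smul {I : Type}
    (f : MultilinearMap k (fun _ : Option I => A) A) (c : k) (x : A) (a : I → A) :
    f (fun o => o.elim (c • x) a) = c • f (fun o => o.elim x a) := by
  classical
  rw [option_elim_eq_update (c • x), option_elim_eq_update x, f.map_update_smul]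

theorem multilinear_option_elim_zero {I : Type}
    (f : MultilinearMap k (fun _ : Option I => A) A) (a : I → A) :
    f (fun o => o.elim 0 a) = 0 :=
  f.map_coord_zero none rfl

end OptionElim

namespace Interp

variable {k : Type u} [CommRing k] {U : Type} {V : Type w} {A : Type v} [AddCommGroup A]
  [Module k A] (M : Interp k U V A)

theorem evalFree_comp {I J : Type} [Finite I] [Finite J] (p : (freeOperad k U V).obj (Option I))
    (q : (freeOperad k U V).obj J) (a : I ⊕ J → A) :
    M.evalFree ((freeOperad k U V).comp p q) a =
      M.evalFree p (fun o => o.elim (M.evalFree q (fun j => a (.inr j))) (fun i => a (.inl i))) := by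
  induction p using freeOperad_induction with
  | zero => simp
  | add z z' h h' => simp only [map_add, LinearMap.add_apply, add_apply, h, h']
  | smul_mono c t ht =>
    rw [map_smul, LinearMap.smul_apply, map_smul, map_smul, smul_apply, smul_apply]
    congr 1
    induction q using freeOperad_induction with
    | zero =>
      rw [map_zero, map_zero, map_zero, zero_apply]
      exact (multilinear_option_elim_zero _ _).symm
    | add z z' h h' => simp only [map_add, add_apply, multilinear_option_elim_add, h, h']
    | smul_mono d s hs =>
      rw [map_smul, map_smul, map_smul, smul_apply, smul_apply, multilinear_option_elim_smul,
        freeOperad_comp_mono, evalFree_mono, evalFree_mono, evalFree_mono, eval_graft]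

/-- The relations `S` hold for all values of the variables. -/
def Satisfies (S : Relations k U V) : Prop :=
  ∀ (n : ℕ), ∀ r ∈ S n, ∀ a : Fin n → A, M.evalFree r a = 0

variable {M} in
/-- Consequences of relations hold wherever the relations do. -/
theorem Satisfies.evalFree_eq_zero {S : Relations k U V} (hM : M.Satisfies S) {I : Type}
    [Finite I] {z : (freeOperad k U V).obj I} (hz : Operad.InSpan (freeOperad k U V) S I z) :
    M.evalFree z = 0 := by
  induction hz with
  | rel hx => exact MultilinearMap.ext fun a => hM _ _ hx a
  | zero => simp
  | add _ _ hx hy => rw [map_add, hx, hy, add_zero]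
  | smul c _ hx => rw [map_smul, hx, smul_zero]
  | map e _ hx => ext a; rw [evalFree_map, hx]; rfl
  | compLeft y _ hx => ext a; rw [evalFree_comp, hx]; rfl
  | compRight x _ hy =>
    ext a
    rw [evalFree_comp, hy]
    exact multilinear_option_elim_zero _ _

end Interp

/-! ### The free algebra over a presented operad -/

section FreeAlgebra

namespace OpTree

variable {U : Type} {V : Type w} {I J X Y : Type}

theorem IsLinear.un {t : OpTree U V I} (ht : t.IsLinear) (c : U) : (OpTree.un c t).IsLinear := ht

theorem IsLinear.bin {t : OpTree U V I} {s : OpTree U V J} (ht : t.IsLinear) (hs : s.IsLinear)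
    (ω : V) : (OpTree.bin ω (t.map Sum.inl) (s.map Sum.inr)).IsLinear := by
  constructor
  · rw [leaves, leaves_map, leaves_map, List.nodup_append']
    refine ⟨ht.1.map Sum.inl_injective, hs.1.map Sum.inr_injective, ?_⟩
    intro x hx hx'
    obtain ⟨i, -, rfl⟩ := List.mem_map.1 hx
    obtain ⟨j, -, h⟩ := List.mem_map.1 hx'
    cases h
  · rintro (i | j)
    · exact List.mem_append_left _ (by rw [leaves_map]; exact List.mem_map_of_mem (ht.2 i))
    · exact List.mem_append_right _ (by rw [leaves_map]; exact List.mem_map_of_mem (hs.2 j))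

theorem map_bind (g : I → J) (f : J → OpTree U V X) (t : OpTree U V I) :
    (t.map g).bind f = t.bind fun i => f (g i) :=
  bind_bind _ _ _

theorem map_map (g : I → J) (f : J → X) (t : OpTree U V I) :
    (t.map g).map f = t.map fun i => f (g i) :=
  bind_bind _ _ _

/-- Every tree is obtained by relabelling from a tree with distinct labels. -/
theorem exists_isLinear_map_eq (t : OpTree U V X) :
    ∃ (J : Type) (_ : Finite J) (s : OpTree U V J) (_ : s.IsLinear) (g : J → X), s.map g = t := by
  induction t with
  | leaf i => exact ⟨Unit, inferInstance, leaf (), isLinear_leaf_unit, fun _ => i, rfl⟩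
  | un c t ih =>
    obtain ⟨J, hJ, s, hs, g, rfl⟩ := ih
    exact ⟨J, hJ, .un c s, hs.un c, g, rfl⟩
  | bin ω l r hl hr =>
    obtain ⟨J, hJ, s, hs, g, rfl⟩ := hl
    obtain ⟨J', hJ', s', hs', g', rfl⟩ := hr
    refine ⟨J ⊕ J', inferInstance, .bin ω (s.map .inl) (s'.map .inr), hs.bin hs' ω,
      Sum.elim g g', ?_⟩
    change bin ω ((s.map _).map _) ((s'.map _).map _) = _
    rw [map_map, map_map]
    rfl

theorem IsLinear.bin_left {t : OpTree U V I} (ht : t.IsLinear) (ω : V) :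
    (OpTree.bin ω (t.map some) (leaf none)).IsLinear := by
  have := (ht.bin isLinear_leaf_unit ω).map (sumUnit I)
  change (OpTree.bin ω ((t.map _).map _) _).IsLinear at this
  rwa [map_map] at this

theorem IsLinear.bin_right {t : OpTree U V I} (ht : t.IsLinear) (ω : V) :
    (OpTree.bin ω (leaf none) (t.map some)).IsLinear := by
  have := (isLinear_leaf_unit.bin ht ω).map ((Equiv.sumComm Unit I).trans (sumUnit I))
  change (OpTree.bin ω _ ((t.map _).map _)).IsLinear at this
  rwa [map_map] at this

theorem bijective_of_isLinear_map {t : OpTree U V I} (ht : t.IsLinear) {g : I → J}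
    (h : (t.map g).IsLinear) : Function.Bijective g := by
  rw [IsLinear, leaves_map] at h
  constructor
  · intro i j hij
    exact List.inj_on_of_nodup_map h.1 (ht.2 i) (ht.2 j) hij
  · intro j
    obtain ⟨i, -, hi⟩ := List.mem_map.1 (h.2 j)
    exact ⟨i, hi⟩

end OpTree

open OpTree

variable {k : Type u} [CommRing k] {U : Type} {V : Type w}

section Substitution

variable {I J X : Type} [Finite I] [Finite J]

/-- Simultaneous grafting of trees, with arbitrary labels, at the leaves of an element of the free
operad. -/
noncomputable def bindFree (f : I → OpTree U V X) :
    (freeOperad k U V).obj I →ₗ[k] (OpTree U V X →₀ k) :=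
  freeLin fun t => Finsupp.single (t.1.bind f) 1

theorem bindFree_mono (f : I → OpTree U V X) (t : OpTree U V I) (ht : t.IsLinear) :
    bindFree f (mono (k := k) t ht) = Finsupp.single (t.bind f) 1 :=
  freeLin_mono _ _ _

theorem bindFree_map (e : I ≃ J) (f : J → OpTree U V X) (z : (freeOperad k U V).obj I) :
    bindFree f ((freeOperad k U V).map e z) = bindFree (fun i => f (e i)) z := by
  have : bindFree f ∘ₗ (freeOperad k U V).map e = bindFree (fun i => f (e i)) := by
    apply freeOperad_hom_ext
    intro t ht
    rw [LinearMap.comp_apply, freeOperad_map_mono, bindFree_mono, bindFree_mono, map_bind]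
  exact LinearMap.congr_fun this z

theorem bindFree_comp_mono (z : (freeOperad k U V).obj (Option I)) (s : OpTree U V J)
    (hs : s.IsLinear) (f : I ⊕ J → OpTree U V X) :
    bindFree f ((freeOperad k U V).comp z (mono s hs)) =
      bindFree (fun o => o.elim (s.bind fun j => f (.inr j)) fun i => f (.inl i)) z := by
  have : bindFree f ∘ₗ (freeOperad k U V).comp.flip (mono s hs) =
      bindFree (fun o => o.elim (s.bind fun j => f (.inr j)) fun i => f (.inl i)) := by
    apply freeOperad_hom_ext
    intro t ht
    rw [LinearMap.comp_apply, LinearMap.flip_apply, freeOperad_comp_mono, bindFree_mono,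
      bindFree_mono, graft, bind_bind]
    congr 2
    funext o
    rcases o with _ | i
    · exact map_bind _ _ _
    · rfl
  exact LinearMap.congr_fun this z

/-- Every consequence of relations in variables that are replaced by trees is a consequence of
the relations in other variables, some of which have been identified. -/
theorem exists_inSpan_bindFree_leaf {S : Relations k U V} (z : (freeOperad k U V).obj I)
    (hz : Operad.InSpan _ S I z) (f : I → OpTree U V X) :
    ∃ (J : Type) (_ : Finite J) (z' : (freeOperad k U V).obj J) (g : J → X),
      Operad.InSpan _ S J z' ∧ bindFree (fun j => leaf (g j)) z' = bindFree f z := by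
  -- The trees are grafted one at a time: those at `I` are still to be grafted, and the inputs
  -- in `J` have been dealt with.
  let motive : Type → Prop := fun I => ∀ [Finite I] (J : Type) [Finite J]
      (z : (freeOperad k U V).obj (I ⊕ J)) (_ : Operad.InSpan _ S (I ⊕ J) z)
      (f : I → OpTree U V X) (g : J → X),
      ∃ (J' : Type) (_ : Finite J') (z' : (freeOperad k U V).obj J') (g' : J' → X),
        Operad.InSpan _ S J' z' ∧ bindFree (fun j => leaf (g' j)) z' =
          bindFree (Sum.elim f fun j => leaf (g j)) z
  have key : motive I := by
    refine Finite.induction_empty_option (P := motive) ?_ ?_ ?_ I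
    · intro α β e ih _ J _ z hz f g
      have : Finite α := .of_equiv _ e.symm
      obtain ⟨J', hJ', z', g', hz', h⟩ := ih J _ (hz.map (Equiv.sumCongr e.symm (Equiv.refl J)))
        (fun i => f (e i)) g
      refine ⟨J', hJ', z', g', hz', h.trans ?_⟩
      rw [bindFree_map]
      congr 2
      funext o
      rcases o with i | j <;> simp
    · intro _ J _ z hz f g
      refine ⟨J, inferInstance, _, g, hz.map (Equiv.emptySum PEmpty J), ?_⟩
      rw [bindFree_map]
      congr 2
      funext o
      rcases o with i | j
      · exact i.elim
      · rfl
    · intro α _ ih _ J _ z hz f g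
      obtain ⟨K, hK, s, hs, l, hl⟩ := exists_isLinear_map_eq (f none)
      obtain ⟨J', hJ', z', g', hz', h⟩ := ih (J ⊕ K)
        _ (((hz.map (optionSum α J)).compLeft (mono s hs)).map (Equiv.sumAssoc α J K))
        (fun i => f (some i)) (Sum.elim g l)
      refine ⟨J', hJ', z', g', hz', h.trans ?_⟩
      rw [bindFree_map, bindFree_comp_mono, bindFree_map]
      congr 2
      funext o
      rcases o with (_ | i) | j
      · exact hl
      · rfl
      · rfl
  obtain ⟨J', hJ', z', g', hz', h⟩ := key Empty _ (hz.map (Equiv.sumEmpty I Empty).symm) f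
    (fun i => i.elim)
  refine ⟨J', hJ', z', g', hz', h.trans ?_⟩
  rw [bindFree_map]
  rfl

open Classical in
/-- The projection that discards all trees with repeated or missing labels. -/
noncomputable def linPart : (OpTree U V I →₀ k) →ₗ[k] (freeOperad k U V).obj I :=
  Finsupp.linearCombination k fun t => if h : t.IsLinear then mono t h else 0

theorem linPart_single (t : OpTree U V I) (ht : t.IsLinear) :
    linPart (Finsupp.single t (1 : k)) = mono t ht := by
  rw [linPart, Finsupp.linearCombination_single, one_smul, dif_pos ht]

theorem linPart_single_of_not (t : OpTree U V I) (ht : ¬ t.IsLinear) :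
    linPart (Finsupp.single t (1 : k)) = 0 := by
  rw [linPart, Finsupp.linearCombination_single, one_smul, dif_neg ht]

/-- The relations being multilinear, the multilinear part of a consequence of them is a
consequence of them in the operad. -/
theorem inSpan_linPart_bindFree {S : Relations k U V} {z : (freeOperad k U V).obj I}
    (hz : Operad.InSpan _ S I z) (f : I → OpTree U V J) :
    Operad.InSpan _ S J (linPart (bindFree f z)) := by
  obtain ⟨K, hK, z', g, hz', h⟩ := exists_inSpan_bindFree_leaf z hz f
  rw [← h]
  by_cases hg : Function.Bijective g
  · have : linPart ∘ₗ bindFree (fun j => leaf (g j)) =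
        (freeOperad k U V).map (Equiv.ofBijective g hg) := by
      apply freeOperad_hom_ext
      intro t ht
      rw [freeOperad_map_mono, LinearMap.comp_apply, bindFree_mono]
      exact linPart_single _ (ht.map (Equiv.ofBijective g hg))
    have := LinearMap.congr_fun this z'
    rw [LinearMap.comp_apply] at this
    rw [this]
    exact hz'.map _
  · have : linPart ∘ₗ bindFree (k := k) (fun j => (leaf (g j) : OpTree U V J)) = 0 := by
      apply freeOperad_hom_ext
      intro t ht
      rw [LinearMap.comp_apply, bindFree_mono]
      exact linPart_single_of_not _ fun h' => hg (bijective_of_isLinear_map ht h')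
    have := LinearMap.congr_fun this z'
    rw [LinearMap.comp_apply] at this
    rw [this]
    exact .zero

theorem isLinear_un_leaf (c : U) : (OpTree.un c (leaf none) : OpTree U V (Option Empty)).IsLinear := by
  constructor
  · simp [leaves]
  · rintro (_ | i)
    · simp [leaves]
    · exact i.elim

theorem isLinear_bin_leaf_left (ω : V) :
    (OpTree.bin ω (leaf none) (leaf (some ())) : OpTree U V (Option Unit)).IsLinear := by
  constructor
  · simp [leaves]
  · rintro (_ | i) <;> simp [leaves]

theorem isLinear_bin_leaf_right (ω : V) :
    (OpTree.bin ω (leaf (some ())) (leaf none) : OpTree U V (Option Unit)).IsLinear := by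
  constructor
  · simp [leaves]
  · rintro (_ | i) <;> simp [leaves]

/-- Consequences of relations may be put under a unary vertex: the vertex is composed with them in
the operad. -/
theorem inSpan_un {S : Relations k U V} {z : (freeOperad k U V).obj I}
    (hz : Operad.InSpan _ S I z) (c : U) :
    Operad.InSpan _ S I (freeLin (fun t => mono (.un c t.1) (t.2.un c)) z) := by
  have : freeLin (fun t => mono (.un c t.1) (t.2.un c)) =
      (freeOperad k U V).map (Equiv.emptySum Empty I) ∘ₗ (freeOperad k U V).comp
        (mono _ (isLinear_un_leaf c)) := by
    apply freeOperad_hom_ext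
    intro t ht
    rw [freeLin_mono, LinearMap.comp_apply, freeOperad_comp_mono, freeOperad_map_mono]
    congr 1
    change un c t = un c ((t.map _).map _)
    rw [map_map]
    exact congrArg _ (bind_leaf t).symm
  rw [this]
  exact (hz.compRight _).map _

/-- Consequences of relations may be put to the left of a new variable `none` under a binary
vertex. -/
theorem inSpan_bin_left {S : Relations k U V} {z : (freeOperad k U V).obj I}
    (hz : Operad.InSpan _ S I z) (ω : V) :
    Operad.InSpan _ S (Option I)
      (freeLin (fun t => mono (.bin ω (t.1.map some) (.leaf none)) (IsLinear.bin_left t.2 ω)) z) := by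
  have : freeLin (fun t => mono (.bin ω (t.1.map some) (.leaf none)) (IsLinear.bin_left t.2 ω)) =
      (freeOperad k U V).map ((Equiv.sumComm Unit I).trans (sumUnit I)) ∘ₗ
        (freeOperad k U V).comp
        (mono _ (isLinear_bin_leaf_left ω)) := by
    apply freeOperad_hom_ext
    intro t ht
    rw [freeLin_mono, LinearMap.comp_apply, freeOperad_comp_mono, freeOperad_map_mono]
    congr 1
    change bin ω _ _ = bin ω ((t.map _).map _) _
    rw [map_map]
    rfl
  rw [this]
  exact (hz.compRight _).map _

/-- Consequences of relations may be put to the right of a new variable `none` under a binary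
vertex. -/
theorem inSpan_bin_right {S : Relations k U V} {z : (freeOperad k U V).obj I}
    (hz : Operad.InSpan _ S I z) (ω : V) :
    Operad.InSpan _ S (Option I)
      (freeLin (fun t => mono (.bin ω (.leaf none) (t.1.map some)) (IsLinear.bin_right t.2 ω)) z) := by
  have : freeLin (fun t => mono (.bin ω (.leaf none) (t.1.map some)) (IsLinear.bin_right t.2 ω)) =
      (freeOperad k U V).map ((Equiv.sumComm Unit I).trans (sumUnit I)) ∘ₗ
        (freeOperad k U V).comp
        (mono _ (isLinear_bin_leaf_right ω)) := by
    apply freeOperad_hom_ext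
    intro t ht
    rw [freeLin_mono, LinearMap.comp_apply, freeOperad_comp_mono, freeOperad_map_mono]
    congr 1
    change bin ω _ _ = bin ω _ ((t.map _).map _)
    rw [map_map]
    rfl
  rw [this]
  exact (hz.compRight _).map _

end Substitution

section FreeModel

variable (S : Relations k U V) (X : Type)

/-- The consequences of the relations `S` among all trees with labels in `X`, that is, the kernel
of the projection to the free algebra on `X`. -/
noncomputable def consequences : Submodule k (OpTree U V X →₀ k) :=
  Submodule.span k {y | ∃ (I : Type) (_ : Finite I) (f : I → OpTree U V X)
    (z : (freeOperad k U V).obj I), Operad.InSpan _ S I z ∧ bindFree f z = y}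

/-- The free algebra on the set `X` over the operad presented by the relations `S`. -/
abbrev FreeModel : Type (max u w) := (OpTree U V X →₀ k) ⧸ consequences S X

variable {S X}

theorem bindFree_mem_consequences {I : Type} [Finite I] (f : I → OpTree U V X)
    {z : (freeOperad k U V).obj I} (hz : Operad.InSpan _ S I z) :
    bindFree f z ∈ consequences S X :=
  Submodule.subset_span ⟨I, inferInstance, f, z, hz, rfl⟩

theorem un_mem_consequences (c : U) :
    consequences S X ≤ (consequences S X).comap (Finsupp.lmapDomain k k (OpTree.un c)) := by
  refine Submodule.span_le.2 ?_
  rintro _ ⟨I, hI, f, z, hz, rfl⟩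
  have : Finsupp.lmapDomain k k (OpTree.un c) ∘ₗ bindFree f =
      bindFree f ∘ₗ freeLin (fun t => mono (.un c t.1) (t.2.un c)) := by
    apply freeOperad_hom_ext
    intro t ht
    rw [LinearMap.comp_apply, LinearMap.comp_apply, freeLin_mono, bindFree_mono, bindFree_mono,
      Finsupp.lmapDomain_apply, Finsupp.mapDomain_single]
    rfl
  rw [SetLike.mem_coe, Submodule.mem_comap, ← LinearMap.comp_apply, this]
  exact bindFree_mem_consequences f (inSpan_un hz c)

theorem bin_left_mem_consequences (ω : V) (s : OpTree U V X) :
    consequences S X ≤ (consequences S X).comap (Finsupp.lmapDomain k k fun t => .bin ω t s) := by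
  refine Submodule.span_le.2 ?_
  rintro _ ⟨I, hI, f, z, hz, rfl⟩
  have : Finsupp.lmapDomain k k (fun t => .bin ω t s) ∘ₗ bindFree f =
      bindFree (fun o : Option I => o.elim s f) ∘ₗ freeLin
        (fun t => mono (.bin ω (t.1.map some) (.leaf none)) (IsLinear.bin_left t.2 ω)) := by
    apply freeOperad_hom_ext
    intro t ht
    rw [LinearMap.comp_apply, LinearMap.comp_apply, freeLin_mono, bindFree_mono, bindFree_mono,
      Finsupp.lmapDomain_apply, Finsupp.mapDomain_single, OpTree.bind, map_bind]
    rfl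
  rw [SetLike.mem_coe, Submodule.mem_comap, ← LinearMap.comp_apply, this]
  exact bindFree_mem_consequences _ (inSpan_bin_left hz ω)

theorem bin_right_mem_consequences (ω : V) (s : OpTree U V X) :
    consequences S X ≤ (consequences S X).comap (Finsupp.lmapDomain k k fun t => .bin ω s t) := by
  refine Submodule.span_le.2 ?_
  rintro _ ⟨I, hI, f, z, hz, rfl⟩
  have : Finsupp.lmapDomain k k (fun t => .bin ω s t) ∘ₗ bindFree f =
      bindFree (fun o : Option I => o.elim s f) ∘ₗ freeLin
        (fun t => mono (.bin ω (.leaf none) (t.1.map some)) (IsLinear.bin_right t.2 ω)) := by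
    apply freeOperad_hom_ext
    intro t ht
    rw [LinearMap.comp_apply, LinearMap.comp_apply, freeLin_mono, bindFree_mono, bindFree_mono,
      Finsupp.lmapDomain_apply, Finsupp.mapDomain_single, OpTree.bind, map_bind]
    rfl
  rw [SetLike.mem_coe, Submodule.mem_comap, ← LinearMap.comp_apply, this]
  exact bindFree_mem_consequences _ (inSpan_bin_right hz ω)

/-- The bilinear extension of a binary vertex to linear combinations of trees. -/
noncomputable def binTree (ω : V) :
    (OpTree U V X →₀ k) →ₗ[k] (OpTree U V X →₀ k) →ₗ[k] (OpTree U V X →₀ k) :=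
  Finsupp.linearCombination k fun l => Finsupp.lmapDomain k k fun r => .bin ω l r

theorem binTree_single_left (ω : V) (l : OpTree U V X) :
    binTree (k := k) ω (Finsupp.single l 1) = Finsupp.lmapDomain k k fun r => .bin ω l r := by
  simp [binTree]

theorem binTree_single_right (ω : V) (r : OpTree U V X) :
    (binTree (k := k) ω).flip (Finsupp.single r 1) =
      Finsupp.lmapDomain k k fun l => .bin ω l r := by
  ext l : 2
  simp [binTree]

theorem binTree_mem_right (ω : V) (x : OpTree U V X →₀ k) {y : OpTree U V X →₀ k}
    (hy : y ∈ consequences S X) : binTree ω x y ∈ consequences S X := by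
  induction x using Finsupp.induction_linear with
  | zero => simp
  | add x x' hx hx' =>
    rw [map_add, LinearMap.add_apply]
    exact add_mem hx hx'
  | single l c =>
    rw [← mul_one c, ← smul_eq_mul, ← Finsupp.smul_single, map_smul, LinearMap.smul_apply,
      binTree_single_left]
    exact Submodule.smul_mem _ _ (bin_right_mem_consequences ω l hy)

theorem binTree_mem_left (ω : V) {x : OpTree U V X →₀ k} (hx : x ∈ consequences S X)
    (y : OpTree U V X →₀ k) : binTree ω x y ∈ consequences S X := by
  induction y using Finsupp.induction_linear with
  | zero => simp
  | add y y' hy hy' =>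
    rw [map_add]
    exact add_mem hy hy'
  | single r c =>
    rw [← mul_one c, ← smul_eq_mul, ← Finsupp.smul_single, map_smul, ← LinearMap.flip_apply,
      binTree_single_right]
    exact Submodule.smul_mem _ _ (bin_left_mem_consequences ω r hx)

variable (S X)

/-- The operations of the free algebra. -/
noncomputable def freeModel : Interp k U V (FreeModel S X) where
  un c := Submodule.mapQ _ _ (Finsupp.lmapDomain k k (OpTree.un c)) (un_mem_consequences c)
  bin ω := Submodule.liftQ _
    { toFun := fun x => Submodule.mapQ _ _ (binTree ω x) fun _ hy => binTree_mem_right ω x hy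
      map_add' := fun x y => by ext; simp
      map_smul' := fun c x => by ext; simp }
    fun x hx => by
      refine LinearMap.ext fun y => ?_
      induction y using Submodule.Quotient.induction_on with
      | H y =>
      exact (Submodule.Quotient.mk_eq_zero _).2 (binTree_mem_left ω hx y)

variable {X}

/-- The class of a tree in the free algebra; the classes of the trees `leaf i` are the free
generators. -/
noncomputable def freeModelTree (t : OpTree U V X) : FreeModel S X :=
  Submodule.Quotient.mk (Finsupp.single t 1)

theorem freeModel_eval {Y : Type} (f : Y → OpTree U V X) (t : OpTree U V Y) :
    (freeModel S X).eval (fun i => freeModelTree S (f i)) t = freeModelTree S (t.bind f) := by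
  induction t with
  | leaf i => rfl
  | un c t ih =>
    rw [Interp.eval, ih]
    exact congrArg Submodule.Quotient.mk Finsupp.mapDomain_single
  | bin ω l r hl hr =>
    rw [Interp.eval, hl, hr]
    refine congrArg Submodule.Quotient.mk ?_
    change binTree ω _ _ = _
    rw [binTree_single_left]
    exact Finsupp.mapDomain_single

theorem freeModel_evalFree {I : Type} [Finite I] (f : I → OpTree U V X)
    (z : (freeOperad k U V).obj I) :
    (freeModel S X).evalFree z (fun i => freeModelTree S (f i)) =
      Submodule.Quotient.mk (bindFree f z) := by
  induction z using freeOperad_induction with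
  | zero => simp
  | add z z' h h' => rw [map_add, map_add, add_apply, h, h']; rfl
  | smul_mono c t ht =>
    rw [map_smul, map_smul, smul_apply, Interp.evalFree_mono, freeModel_eval, bindFree_mono]
    rfl

variable (X) in
theorem span_range_freeModelTree :
    Submodule.span k (Set.range (freeModelTree S (X := X))) = ⊤ := by
  rw [eq_top_iff]
  rintro ⟨x⟩ -
  change Submodule.Quotient.mk x ∈ _
  induction x using Finsupp.induction_linear with
  | zero => exact zero_mem _
  | add x y hx hy => exact add_mem hx hy
  | single t c =>
    rw [← mul_one c, ← smul_eq_mul, ← Finsupp.smul_single, Submodule.Quotient.mk_smul]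
    exact Submodule.smul_mem _ _ (Submodule.subset_span ⟨t, rfl⟩)

variable (X) in
/-- The free algebra satisfies the relations: by multilinearity it suffices to substitute trees, and
substitution instances of relations are consequences by definition. -/
theorem freeModel_satisfies : (freeModel S X).Satisfies S := by
  intro n r hr a
  have : (freeModel S X).evalFree r = 0 := by
    refine MultilinearMap.ext_of_span_eq_top (γ := fun _ => OpTree U V X)
      (g := fun _ => freeModelTree S) (fun _ => span_range_freeModelTree S X) fun f => ?_
    rw [freeModel_evalFree]
    exact (Submodule.Quotient.mk_eq_zero _).2 (bindFree_mem_consequences f (.rel hr))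
  rw [this]
  rfl

/-- The projection of the free algebra on `I` to its multilinear part, which is the component on
`I` of the operad. -/
noncomputable def freeModelRetract (I : Type) [Finite I] :
    FreeModel S I →ₗ[k] (presented S).obj I :=
  Submodule.liftQ _ (Submodule.mkQ (((freeOperad k U V).span S).carrier I) ∘ₗ linPart) <| by
    refine Submodule.span_le.2 ?_
    rintro _ ⟨J, hJ, f, z, hz, rfl⟩
    exact (Submodule.Quotient.mk_eq_zero _).2 (inSpan_linPart_bindFree hz f)

/-- An element of the presented operad is recovered from its value at the generators of the free
algebra. -/
theorem freeModelRetract_evalFree {I : Type} [Finite I] (z : (freeOperad k U V).obj I) :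
    freeModelRetract S I ((freeModel S I).evalFree z fun i => freeModelTree S (.leaf i)) =
      cls S z := by
  rw [freeModel_evalFree]
  change Submodule.Quotient.mk (linPart (bindFree _ z)) = Submodule.Quotient.mk z
  congr 1
  have : linPart ∘ₗ bindFree (k := k) (fun i : I => (leaf i : OpTree U V I)) = LinearMap.id := by
    apply freeOperad_hom_ext
    intro t ht
    rw [LinearMap.comp_apply, bindFree_mono, bind_leaf, linPart_single t ht]
    rfl
  exact LinearMap.congr_fun this z

/-- Completeness: elements of the free operad that agree in all algebras are equal in the presented
operad. -/
theorem cls_eq_of_forall {I : Type} [Finite I] {z z' : (freeOperad k U V).obj I}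
    (h : ∀ (A : Type (max u w)) [AddCommGroup A] [Module k A] (M : Interp k U V A),
      M.Satisfies S → ∀ a : I → A, M.evalFree z a = M.evalFree z' a) : cls S z = cls S z' := by
  rw [← freeModelRetract_evalFree, ← freeModelRetract_evalFree,
    h _ _ (freeModel_satisfies S I)]

end FreeModel

end FreeAlgebra

/-! ### Substitution of operations in trees -/

/-- A multilinear map in one variable as a linear map. -/
def linearOfMultilinear {k : Type u} [CommRing k] {A : Type v} [AddCommGroup A] [Module k A]
    (f : MultilinearMap k (fun _ : Unit => A) A) : A →ₗ[k] A where
  toFun x := f fun _ => x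
  map_add' x y := by
    have h : ∀ z : A, (fun _ : Unit => z) = Function.update (fun _ => 0) () z := fun z => by
      funext i; simp
    rw [h (x + y), h x, h y, f.map_update_add]
  map_smul' c x := by
    have h : ∀ z : A, (fun _ : Unit => z) = Function.update (fun _ => 0) () z := fun z => by
      funext i; simp
    rw [h (c • x), h x, f.map_update_smul, RingHom.id_apply]

/-- A multilinear map in two variables as a bilinear map. -/
def bilinearOfMultilinear {k : Type u} [CommRing k] {A : Type v} [AddCommGroup A] [Module k A]
    (f : MultilinearMap k (fun _ : Fin 2 => A) A) : A →ₗ[k] A →ₗ[k] A :=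
  LinearMap.mk₂ k (fun x y => f ![x, y])
    (fun x x' y => f.cons_add ![y] x x')
    (fun c x y => f.cons_smul ![y] c x)
    (fun x y y' => by
      have h : ∀ z : A, ![x, z] = Function.update ![x, 0] 1 z := fun z => by
        funext i; fin_cases i <;> rfl
      rw [h (y + y'), h y, h y', f.map_update_add])
    (fun c x y => by
      have h : ∀ z : A, ![x, z] = Function.update ![x, 0] 1 z := fun z => by
        funext i; fin_cases i <;> rfl
      rw [h (c • y), h y, f.map_update_smul])

/-- A rule that replaces every unary and every binary operation by a tree in new operations that
uses each argument exactly once. -/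
structure TreeSubst (U : Type) (V : Type w₁) (U' : Type) (V' : Type w₂) where
  un : U → LinTree U' V' Unit
  bin : V → LinTree U' V' (Fin 2)

namespace TreeSubst

variable {k : Type u} [CommRing k] {U U' : Type} {V : Type w₁} {V' : Type w₂}
  (σ : TreeSubst U V U' V') {I J X Y : Type}

/-- The replacement carried out in a tree. -/
def apply : OpTree U V X → OpTree U' V' X
  | .leaf i => .leaf i
  | .un c t => (σ.un c).1.bind fun _ => apply t
  | .bin ω l r => (σ.bin ω).1.bind ![apply l, apply r]

theorem apply_bind (f : X → OpTree U V Y) (t : OpTree U V X) :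
    σ.apply (t.bind f) = (σ.apply t).bind fun i => σ.apply (f i) := by
  induction t with
  | leaf i => rfl
  | un c t ih => simp only [OpTree.bind, apply, ih, OpTree.bind_bind]
  | bin ω l r hl hr =>
    simp only [OpTree.bind, apply, hl, hr, OpTree.bind_bind]
    congr 1
    funext i
    fin_cases i <;> rfl

theorem apply_map (f : X → Y) (t : OpTree U V X) : σ.apply (t.map f) = (σ.apply t).map f :=
  σ.apply_bind _ t

theorem apply_graft (t : OpTree U V (Option I)) (s : OpTree U V J) :
    σ.apply (t.graft s) = (σ.apply t).graft (σ.apply s) := by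
  rw [OpTree.graft, OpTree.graft, apply_bind]
  congr 1
  funext o
  rcases o with _ | i
  · exact σ.apply_map _ s
  · rfl

theorem leaves_apply (t : OpTree U V X) : (σ.apply t).leaves.Perm t.leaves := by
  induction t with
  | leaf i => exact .refl _
  | un c t ih =>
    have h : (σ.un c).1.leaves.Perm [()] :=
      (List.perm_ext_iff_of_nodup (σ.un c).2.1 (by simp)).2 fun i => by simp [(σ.un c).2.2 i]
    rw [apply, OpTree.leaves_bind]
    refine (h.flatMap_right _).trans ?_
    simpa [OpTree.leaves] using ih
  | bin ω l r hl hr =>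
    have h : (σ.bin ω).1.leaves.Perm [0, 1] :=
      (List.perm_ext_iff_of_nodup (σ.bin ω).2.1 (by simp)).2 fun i => by
        fin_cases i <;> simp [(σ.bin ω).2.2 _]
    rw [apply, OpTree.leaves_bind]
    refine (h.flatMap_right _).trans ?_
    simpa [OpTree.leaves] using hl.append hr

theorem isLinear_apply {t : OpTree U V X} (ht : t.IsLinear) : (σ.apply t).IsLinear :=
  ⟨(σ.leaves_apply t).nodup_iff.2 ht.1, fun i => (σ.leaves_apply t).mem_iff.2 (ht.2 i)⟩

/-- The interpretation of the old operations by means of an interpretation of the new ones. -/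
def pullback {A : Type v} [AddCommGroup A] [Module k A] (M : Interp k U' V' A) :
    Interp k U V A where
  un c := linearOfMultilinear (M.evalTree (σ.un c))
  bin ω := bilinearOfMultilinear (M.evalTree (σ.bin ω))

theorem pullback_bin {A : Type v} [AddCommGroup A] [Module k A] (M : Interp k U' V' A) (ω : V)
    (x y : A) : (σ.pullback M).bin ω x y = M.eval ![x, y] (σ.bin ω).1 := rfl

theorem eval_apply {A : Type v} [AddCommGroup A] [Module k A] (M : Interp k U' V' A) (a : X → A)
    (t : OpTree U V X) : M.eval a (σ.apply t) = (σ.pullback M).eval a t := by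
  induction t with
  | leaf i => rfl
  | un c t ih => rw [apply, Interp.eval_bind, ih]; rfl
  | bin ω l r hl hr =>
    rw [apply, Interp.eval_bind, Interp.eval, ← hl, ← hr, pullback_bin]
    congr 1
    funext i
    fin_cases i <;> rfl

end TreeSubst

/-! ### Morphisms out of free and presented operads -/

namespace Operad

variable {k : Type u} [CommRing k] {U U' : Type} {V : Type w₁} {V' : Type w₂}

theorem Hom.ext {P : Operad.{u, w₁} k} {Q : Operad.{u, w₂} k} {f g : Hom P Q}
    (h : ∀ (I : Type) [Finite I], f.app I = g.app I) : f = g := by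
  obtain ⟨f, _, _, _⟩ := f
  obtain ⟨g, _, _, _⟩ := g
  obtain rfl : @f = @g := by
    funext I hI
    exact h I
  rfl

/-- The identity morphism. -/
def Hom.id (P : Operad.{u, w} k) : Hom P P where
  app _ _ := .id
  app_map _ _ := rfl
  app_one := rfl
  app_comp _ _ := rfl

theorem Hom.comp_app {P : Operad.{u, w₁} k} {Q : Operad.{u, w₂} k}
    {R : Operad.{u, w₃} k} (g : Hom Q R) (f : Hom P Q) {I : Type} [Finite I] (x : P.obj I) :
    (g.comp f).app I x = g.app I (f.app I x) := rfl

/-- The morphism from the free operad with given values on trees. -/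
noncomputable def freeHom {Q : Operad.{u, w} k}
    (F : ∀ (I : Type) [Finite I], LinTree U V I → Q.obj I)
    (hmap : ∀ {I J : Type} [Finite I] [Finite J] (e : I ≃ J) (t : LinTree U V I),
      F J (t.map e) = Q.map e (F I t))
    (hone : F Unit ⟨.leaf (), isLinear_leaf_unit⟩ = Q.one)
    (hcomp : ∀ {I J : Type} [Finite I] [Finite J] (t : LinTree U V (Option I)) (s : LinTree U V J),
      F (I ⊕ J) (t.graft s) = Q.comp (F (Option I) t) (F J s)) :
    Hom (freeOperad k U V) Q where
  app I _ := freeLin (F I)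
  app_map e p := by
    induction p using freeOperad_induction with
    | zero => simp only [map_zero]
    | add x y hx hy => simp only [map_add, hx, hy]
    | smul_mono c t ht =>
      simp only [map_smul, freeOperad_map_mono, freeLin_mono]
      rw [← hmap]
      rfl
  app_one := by rw [freeOperad_one, freeLin_mono, hone]
  app_comp p q := by
    induction p using freeOperad_induction with
    | zero => simp only [map_zero, LinearMap.zero_apply]
    | add x y hx hy => simp only [map_add, LinearMap.add_apply, hx, hy]
    | smul_mono c t ht =>
      simp only [map_smul, LinearMap.smul_apply]
      congr 1
      induction q using freeOperad_induction with
      | zero => simp only [map_zero]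
      | add x y hx hy => simp only [map_add, hx, hy]
      | smul_mono d s hs =>
        simp only [map_smul, freeOperad_comp_mono, freeLin_mono]
        rw [← hcomp]
        rfl

/-- The morphism of free operads that replaces the operations by trees. -/
noncomputable def substHom (k : Type u) [CommRing k] (σ : TreeSubst U V U' V') :
    Hom (freeOperad k U V) (freeOperad k U' V') :=
  freeHom (fun _ _ t => mono (σ.apply t.1) (σ.isLinear_apply t.2))
    (fun e t => by
      rw [freeOperad_map_mono]
      congr 1
      exact σ.apply_map _ _)
    rfl
    (fun t s => by
      rw [freeOperad_comp_mono]
      congr 1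
      exact σ.apply_graft _ _)

theorem substHom_mono (σ : TreeSubst U V U' V') {I : Type} [Finite I] (t : OpTree U V I)
    (ht : t.IsLinear) :
    (substHom k σ).app I (mono t ht) = mono (σ.apply t) (σ.isLinear_apply ht) :=
  freeLin_mono _ _ _

theorem evalFree_substHom (σ : TreeSubst U V U' V') {A : Type v} [AddCommGroup A] [Module k A]
    (M : Interp k U' V' A) {I : Type} [Finite I] (z : (freeOperad k U V).obj I) :
    M.evalFree ((substHom k σ).app I z) = (σ.pullback M).evalFree z := by
  have : M.evalFree ∘ₗ (substHom k σ).app I = (σ.pullback M).evalFree := by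
    apply freeOperad_hom_ext
    intro t ht
    ext a
    rw [LinearMap.comp_apply, substHom_mono, Interp.evalFree_mono, Interp.evalFree_mono,
      σ.eval_apply]
  exact LinearMap.congr_fun this z

/-- The projection from the free operad to a presented operad. -/
noncomputable def clsHom (S : Relations k U V) : Hom (freeOperad k U V) (presented S) where
  app _ _ := Submodule.mkQ _
  app_map _ _ := rfl
  app_one := rfl
  app_comp _ _ := rfl

/-- Morphisms from a presented operad are given by morphisms from the free operad that send the
relations to zero. -/
noncomputable def presentedHom {S : Relations k U V} {Q : Operad.{u, w} k}
    (f : Hom (freeOperad k U V) Q) (hf : ∀ n, ∀ r ∈ S n, f.app (Fin n) r = 0) :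
    Hom (presented S) Q where
  app I _ := Submodule.liftQ _ (f.app I) fun z hz => by
    change InSpan _ S I z at hz
    change f.app I z = 0
    induction hz with
    | rel hx => exact hf _ _ hx
    | zero => exact map_zero _
    | add _ _ hx hy => rw [map_add, hx, hy, add_zero]
    | smul c _ hx => rw [map_smul, hx, smul_zero]
    | map e _ hx => rw [f.app_map, hx, map_zero]
    | compLeft y _ hx => rw [f.app_comp, hx, map_zero, LinearMap.zero_apply]
    | compRight x _ hy => rw [f.app_comp, hy, map_zero]
  app_map := by
    rintro _ _ _ _ e ⟨p⟩
    exact f.app_map e p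
  app_one := f.app_one
  app_comp := by
    rintro I J _ _ ⟨p⟩ ⟨q⟩
    exact f.app_comp p q

theorem presentedHom_cls {S : Relations k U V} {Q : Operad.{u, w} k}
    (f : Hom (freeOperad k U V) Q) (hf : ∀ n, ∀ r ∈ S n, f.app (Fin n) r = 0) {I : Type}
    [Finite I] (z : (freeOperad k U V).obj I) :
    (presentedHom f hf).app I (cls S z) = f.app I z := rfl

/-- Morphisms from a presented operad are equal if they agree on trees. -/
theorem presented_hom_ext {S : Relations k U V} {Q : Operad.{u, w} k} {f g : Hom (presented S) Q}
    (h : ∀ (I : Type) [Finite I] (t : OpTree U V I) (ht : t.IsLinear),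
      f.app I (cls S (mono t ht)) = g.app I (cls S (mono t ht))) : f = g :=
  Hom.ext fun I _ => Submodule.linearMap_qext _ <| freeOperad_hom_ext (h I)

/-- The morphism `t ↦ f(t) ⊗ g(t)` (for trees `t`) to the Hadamard product. -/
noncomputable def hadamardPair {P : Operad.{u, w} k} {Q : Operad.{u, w₃} k}
    (f : Hom (freeOperad k U V) P) (g : Hom (freeOperad k U V) Q) :
    Hom (freeOperad k U V) (hadamard P Q) :=
  freeHom (fun I _ t => (f.app I (mono t.1 t.2) ⊗ₜ[k] g.app I (mono t.1 t.2) :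
      P.obj I ⊗[k] Q.obj I))
    (fun e t => by
      change _ = TensorProduct.map _ _ (_ ⊗ₜ _)
      rw [TensorProduct.map_tmul, ← f.app_map, ← g.app_map, freeOperad_map_mono]
      rfl)
    (by
      change _ = P.one ⊗ₜ Q.one
      rw [← f.app_one, ← g.app_one, freeOperad_one])
    (fun t s => by
      change _ = TensorProduct.map₂ P.comp Q.comp (_ ⊗ₜ _) (_ ⊗ₜ _)
      rw [TensorProduct.map₂_apply_tmul, TensorProduct.map_tmul, ← f.app_comp, ← g.app_comp,
        freeOperad_comp_mono]
      rfl)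

theorem hadamardPair_mono {P : Operad.{u, w} k} {Q : Operad.{u, w₃} k}
    (f : Hom (freeOperad k U V) P) (g : Hom (freeOperad k U V) Q) {I : Type} [Finite I]
    (t : OpTree U V I) (ht : t.IsLinear) :
    (hadamardPair f g).app I (mono t ht) =
      (f.app I (mono t ht) ⊗ₜ[k] g.app I (mono t ht) : P.obj I ⊗[k] Q.obj I) :=
  freeLin_mono _ _ _

end Operad

/-! ### Tensor products of interpretations -/

namespace Interp

variable {k : Type u} [CommRing k] {U : Type} {V : Type w} {A : Type w₁} [AddCommGroup A]
  [Module k A] {B : Type w₂} [AddCommGroup B] [Module k B]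

/-- The tensor product, with all operations acting factorwise. -/
noncomputable def tensor (M : Interp k U V A) (M' : Interp k U V B) : Interp k U V (A ⊗[k] B) where
  un c := TensorProduct.map (M.un c) (M'.un c)
  bin ω := TensorProduct.map₂ (M.bin ω) (M'.bin ω)

theorem tensor_bin_tmul (M : Interp k U V A) (M' : Interp k U V B) (ω : V) (a a' : A) (b b' : B) :
    (M.tensor M').bin ω (a ⊗ₜ b) (a' ⊗ₜ b') = M.bin ω a a' ⊗ₜ M'.bin ω b b' := by
  simp [tensor]

theorem tensor_eval_tmul (M : Interp k U V A) (M' : Interp k U V B) {X : Type} (a : X → A)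
    (b : X → B) (t : OpTree U V X) :
    (M.tensor M').eval (fun i => a i ⊗ₜ[k] b i) t = M.eval a t ⊗ₜ M'.eval b t := by
  induction t with
  | leaf i => rfl
  | un c t ih => rw [eval, ih]; simp [tensor, eval]
  | bin ω l r hl hr => rw [eval, hl, hr, tensor_bin_tmul]; rfl

end Interp

theorem multilinear_ext_tmul {k : Type u} [CommRing k] {A : Type w₁} [AddCommGroup A]
    [Module k A] {B : Type w₂} [AddCommGroup B] [Module k B] {C : Type w₃} [AddCommGroup C]
    [Module k C] {I : Type} [Finite I] {f g : MultilinearMap k (fun _ : I => A ⊗[k] B) C}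
    (h : ∀ (a : I → A) (b : I → B), f (fun i => a i ⊗ₜ b i) = g (fun i => a i ⊗ₜ b i)) : f = g := by
  refine MultilinearMap.ext_of_span_eq_top (γ := fun _ => A × B)
    (g := fun _ p => p.1 ⊗ₜ[k] p.2) (fun _ => ?_) fun j => h _ _
  rw [← TensorProduct.span_tmul_eq_top]
  congr 1
  ext x
  simp

namespace Operad

variable {k : Type u} [CommRing k] {U U₁ U₂ : Type} {V : Type w} {V₁ : Type w₁} {V₂ : Type w₂}

/-- An element of a free operad is sent to zero in a presented operad if it vanishes in all
algebras. -/
theorem clsHom_substHom_eq_zero {T : Relations k U₁ V₁} (σ : TreeSubst U V U₁ V₁) {I : Type}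
    [Finite I] {z : (freeOperad k U V).obj I}
    (h : ∀ (A : Type (max u w₁)) [AddCommGroup A] [Module k A] (M : Interp k U₁ V₁ A),
      M.Satisfies T → ∀ a : I → A, (σ.pullback M).evalFree z a = 0) :
    ((clsHom T).comp (substHom k σ)).app I z = 0 := by
  change cls T ((substHom k σ).app I z) = cls T 0
  refine cls_eq_of_forall T fun A _ _ M hM a => ?_
  rw [evalFree_substHom, h A M hM, map_zero]
  rfl

/-- An element of a free operad is sent to zero in a Hadamard product of presented operads if it
vanishes in all tensor products of algebras. -/
theorem hadamardPair_substHom_eq_zero {P : Operad.{u, w₃} k} {S : Relations k U₁ V₁}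
    {T : Relations k U₂ V₂} (e : Hom (presented S) P) (σ : TreeSubst U V U₁ V₁)
    (τ : TreeSubst U V U₂ V₂) {I : Type} [Finite I] {z : (freeOperad k U V).obj I}
    (h : ∀ (A : Type (max u w₁)) [AddCommGroup A] [Module k A] (M : Interp k U₁ V₁ A)
      (B : Type (max u w₂)) [AddCommGroup B] [Module k B] (M' : Interp k U₂ V₂ B),
      M.Satisfies S → M'.Satisfies T → ∀ (a : I → A) (b : I → B),
        ((σ.pullback M).tensor (τ.pullback M')).evalFree z (fun i => a i ⊗ₜ b i) = 0) :
    (hadamardPair (e.comp ((clsHom S).comp (substHom k σ)))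
      ((clsHom T).comp (substHom k τ))).app I z = 0 := by
  let a : I → FreeModel S I := fun i => freeModelTree S (.leaf i)
  let b : I → FreeModel T I := fun i => freeModelTree T (.leaf i)
  let N := (σ.pullback (freeModel S I)).tensor (τ.pullback (freeModel T I))
  let ev : MultilinearMap k (fun _ : I => FreeModel S I ⊗[k] FreeModel T I)
      (FreeModel S I ⊗[k] FreeModel T I) →ₗ[k] FreeModel S I ⊗[k] FreeModel T I :=
    ⟨⟨fun f => f fun i => a i ⊗ₜ b i, fun _ _ => rfl⟩, fun _ _ => rfl⟩
  let ρ : FreeModel S I ⊗[k] FreeModel T I →ₗ[k] P.obj I ⊗[k] (presented T).obj I :=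
    TensorProduct.map (e.app I ∘ₗ freeModelRetract S I) (freeModelRetract T I)
  -- The morphism is evaluation at the pure tensors of generators in the tensor product of the two
  -- free algebras, followed by the tensor product of the two retractions.
  have key : (hadamardPair (e.comp ((clsHom S).comp (substHom k σ)))
      ((clsHom T).comp (substHom k τ))).app I = ρ ∘ₗ ev ∘ₗ N.evalFree := by
    apply freeOperad_hom_ext
    intro t ht
    rw [hadamardPair_mono]
    change e.app I (cls S ((substHom k σ).app I (mono t ht))) ⊗ₜ[k]
        cls T ((substHom k τ).app I (mono t ht)) =
      ρ (N.evalFree (mono t ht) fun i => a i ⊗ₜ b i)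
    rw [substHom_mono, substHom_mono, ← freeModelRetract_evalFree, ← freeModelRetract_evalFree,
      Interp.evalFree_mono, Interp.evalFree_mono, Interp.evalFree_mono, Interp.tensor_eval_tmul,
      σ.eval_apply, τ.eval_apply]
    exact (TensorProduct.map_tmul _ _ _ _).symm
  rw [key]
  change ρ (N.evalFree z fun i => a i ⊗ₜ b i) = 0
  rw [h _ _ _ _ (freeModel_satisfies S I) (freeModel_satisfies T I), map_zero]

end Operad

/-! ### Values of disuccessors -/

section Splitting

variable {k : Type u} [CommRing k] {V : Type w} {A : Type v} [AddCommGroup A] [Module k A]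
  (N : Interp k Empty (V × Side) A) {X : Type}

theorem evalSum_binSum (a : X → A) (c : V × Side) (x y : OpTree Empty (V × Side) X →₀ k) :
    N.evalSum a (binSum k c x y) = N.bin c (N.evalSum a x) (N.evalSum a y) := by
  simp only [binSum, Interp.evalSum, Finsupp.linearCombination_apply, Finsupp.sum,
    map_sum, LinearMap.sum_apply, map_smul, LinearMap.smul_apply, Finset.smul_sum]
  rw [Finset.sum_comm]
  refine Finset.sum_congr rfl fun r _ => Finset.sum_congr rfl fun l _ => ?_
  change Finsupp.sum (Finsupp.single _ _) (fun t d => d • N.eval a t) = _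
  rw [Finsupp.sum_single_index (by simp), Interp.eval, mul_comm, mul_smul]

theorem evalSum_splitAll_leaf (a : X → A) (i : X) :
    N.evalSum a (splitAll k (.leaf i : OpTree Empty V X)) = a i := by
  simp [splitAll, Interp.eval]

theorem evalSum_splitAll_bin (a : X → A) (ω : V) (l r : OpTree Empty V X) :
    N.evalSum a (splitAll k (.bin ω l r)) =
      N.bin (ω, .prec) (N.evalSum a (splitAll k l)) (N.evalSum a (splitAll k r)) +
        N.bin (ω, .succ) (N.evalSum a (splitAll k l)) (N.evalSum a (splitAll k r)) := by
  rw [splitAll, map_add, evalSum_binSum, evalSum_binSum]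

theorem evalSum_splitAt_leaf (a : X → A) (x i : X) :
    N.evalSum a (splitAt k x (.leaf i : OpTree Empty V X)) = a i := by
  simp [splitAt, Interp.eval]

theorem evalSum_splitAt_bin_of_mem (a : X → A) {x : X} (ω : V) {l : OpTree Empty V X}
    (r : OpTree Empty V X) (h : x ∈ l.leaves) :
    N.evalSum a (splitAt k x (.bin ω l r)) =
      N.bin (ω, .prec) (N.evalSum a (splitAt k x l)) (N.evalSum a (splitAll k r)) := by
  rw [splitAt, if_pos h, evalSum_binSum]

theorem evalSum_splitAt_bin_of_notMem (a : X → A) {x : X} (ω : V) {l : OpTree Empty V X}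
    (r : OpTree Empty V X) (h : x ∉ l.leaves) :
    N.evalSum a (splitAt k x (.bin ω l r)) =
      N.bin (ω, .succ) (N.evalSum a (splitAll k l)) (N.evalSum a (splitAt k x r)) := by
  rw [splitAt, if_neg h, evalSum_binSum]

/-- In the definition of `su`, the restriction to trees with distinct labels loses nothing. -/
theorem evalFree_su_mono {I : Type} [Finite I] (x : I) (t : OpTree Empty V I) (ht : t.IsLinear)
    (a : I → A) : N.evalFree (su k x (mono t ht)) a = N.evalSum a (splitAt k x t) := by
  have : su k x (mono t ht) = Finsupp.subtypeDomain OpTree.IsLinear (splitAt k x t) :=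
    freeLin_mono (fun t : LinTree Empty V I =>
      (Finsupp.subtypeDomain OpTree.IsLinear (splitAt k x t.1) :
        (freeOperad k Empty (V × Side)).obj I)) t ht
  rw [this]
  refine N.evalFree_subtypeDomain _ (fun s hs => ?_) a
  rw [OpTree.IsLinear, leaves_splitAt k x t s hs]
  exact ht

theorem evalFree_su_sub_eq_zero {I : Type} [Finite I] {x : I} {t s : OpTree Empty V I}
    {ht : t.IsLinear} {hs : s.IsLinear} {a : I → A} :
    N.evalFree (su k x (mono t ht - mono s hs)) a = 0 ↔
      N.evalSum a (splitAt k x t) = N.evalSum a (splitAt k x s) := by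
  rw [map_sub, map_sub, sub_apply, evalFree_su_mono, evalFree_su_mono, sub_eq_zero]

end Splitting

section Relations

variable {k : Type u} [CommRing k] {A : Type v} [AddCommGroup A] [Module k A]
  {I : Type} [Finite I] {a : I → A}

theorem inclFree_mono {V : Type w} (t : OpTree Empty V I) (ht : t.IsLinear) :
    inclFree (mono (k := k) t ht) =
      mono t.incl (by rw [OpTree.IsLinear, OpTree.leaves_incl]; exact ht) :=
  Finsupp.mapDomain_single

theorem evalFree_inclFree_sub_eq_zero {V : Type w} (M : Interp k Unit V A)
    {t s : OpTree Empty V I} {ht : t.IsLinear} {hs : s.IsLinear} :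
    M.evalFree (inclFree (mono t ht - mono s hs)) a = 0 ↔ M.eval a t.incl = M.eval a s.incl := by
  rw [map_sub, inclFree_mono, inclFree_mono, map_sub, sub_apply, Interp.evalFree_mono,
    Interp.evalFree_mono, sub_eq_zero]

theorem evalFree_sub_add_eq_zero {U : Type} {V : Type w} (M : Interp k U V A)
    {t s s' : OpTree U V I} {ht : t.IsLinear} {hs : s.IsLinear} {hs' : s'.IsLinear} :
    M.evalFree (mono t ht - (mono s hs + mono s' hs')) a = 0 ↔
      M.eval a t = M.eval a s + M.eval a s' := by
  rw [map_sub, map_add, sub_apply, add_apply, Interp.evalFree_mono, Interp.evalFree_mono,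
    Interp.evalFree_mono, sub_eq_zero]

end Relations

/-! ### The substitutions behind the morphisms -/

section Substitutions

theorem isLinear_fin_two {U : Type} {V : Type w} {t : OpTree U V (Fin 2)}
    (h : t.leaves = [0, 1] ∨ t.leaves = [1, 0]) : t.IsLinear := by
  rw [OpTree.IsLinear]
  rcases h with h | h <;> rw [h] <;> simp [Fin.forall_fin_two]

/-- `ω_≺ ↦ ω(a₁, R(a₂))` and `ω_≻ ↦ ω(R(a₁), a₂)`. -/
def splitRB (V : Type w) : TreeSubst Empty (V × Side) Unit V where
  un a := a.elim
  bin
    | (ω, .prec) => ⟨.bin ω (.leaf 0) (rb (.leaf 1)), isLinear_fin_two (.inl rfl)⟩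
    | (ω, .succ) => ⟨.bin ω (rb (.leaf 0)) (.leaf 1), isLinear_fin_two (.inl rfl)⟩

/-- `R ↦ id` and `ω ↦ ω`. -/
def forgetRB (V : Type w) : TreeSubst Unit V Empty V where
  un _ := ⟨.leaf (), isLinear_leaf_unit (V := V)⟩
  bin ω := ⟨.bin ω (.leaf 0) (.leaf 1), isLinear_fin_two (.inl rfl)⟩

/-- `R ↦ R` and `ω ↦ μ`. -/
def collapseRB (V : Type w) : TreeSubst Unit V Unit Unit where
  un _ := ⟨rb (.leaf ()), OpTree.IsLinear.un isLinear_leaf_unit ()⟩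
  bin _ := ⟨.bin () (.leaf 0) (.leaf 1), isLinear_fin_two (.inl rfl)⟩

/-- `ω_≺ ↦ ω` and `ω_≻ ↦ ω`. -/
def forgetSide (V : Type w) : TreeSubst Empty (V × Side) Empty V where
  un a := a.elim
  bin c := ⟨.bin c.1 (.leaf 0) (.leaf 1), isLinear_fin_two (.inl rfl)⟩

/-- `ω_≺ ↦ ν^op` and `ω_≻ ↦ ν`. -/
def toZinb (V : Type w) : TreeSubst Empty (V × Side) Empty Unit where
  un a := a.elim
  bin
    | (_, .prec) => ⟨.bin () (.leaf 1) (.leaf 0), isLinear_fin_two (.inr rfl)⟩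
    | (_, .succ) => ⟨.bin () (.leaf 0) (.leaf 1), isLinear_fin_two (.inl rfl)⟩

/-- `ν ↦ μ(R(a₁), a₂)`. -/
def zinbRB : TreeSubst Empty Unit Unit Unit where
  un a := a.elim
  bin _ := ⟨.bin () (rb (.leaf 0)) (.leaf 1), isLinear_fin_two (.inl rfl)⟩

/-- `ν ↦ μ_≻`. -/
def zinbSucc : TreeSubst Empty Unit Empty (Unit × Side) where
  un a := a.elim
  bin _ := ⟨.bin ((), .succ) (.leaf 0) (.leaf 1), isLinear_fin_two (.inl rfl)⟩

end Substitutions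

/-! ### Rota–Baxter operators split the operations -/

section RotaBaxter

variable {k : Type u} [CommRing k] {V : Type w} {A : Type v} [AddCommGroup A] [Module k A]
  {M : Interp k Unit V A}

/-- The Rota–Baxter identity. -/
theorem Interp.Satisfies.rotaBaxter {S : Relations k Empty V} (hM : M.Satisfies (RBRel S)) (ω : V)
    (x y : A) :
    M.bin ω (M.un () x) (M.un () y) =
      M.un () (M.bin ω (M.un () x) y + M.bin ω x (M.un () y)) := by
  rw [map_add]
  exact (evalFree_sub_add_eq_zero M).1 (hM 2 _ (.rotaBaxter ω) ![x, y])

/-- The operator turns the sum of the split operations into the original operations. -/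
theorem un_evalSum_splitAll (hM : ∀ ω x y, M.bin ω (M.un () x) (M.un () y) =
      M.un () (M.bin ω (M.un () x) y + M.bin ω x (M.un () y))) {X : Type} (a : X → A)
    (t : OpTree Empty V X) :
    M.un () (((splitRB V).pullback M).evalSum a (splitAll k t)) =
      M.eval (fun i => M.un () (a i)) t.incl := by
  induction t with
  | leaf i => rw [evalSum_splitAll_leaf]; rfl
  | un c t ih => exact c.elim
  | bin ω l r hl hr =>
    rw [evalSum_splitAll_bin, OpTree.incl, Interp.eval, ← hl, ← hr, hM, add_comm]
    rfl

/-- The disuccessor at `x` of a tree `t` acts as `t` with the operator applied to all arguments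
except the one at `x`. -/
theorem evalSum_splitAt_splitRB (hM : ∀ ω x y, M.bin ω (M.un () x) (M.un () y) =
      M.un () (M.bin ω (M.un () x) y + M.bin ω x (M.un () y))) {X : Type} [DecidableEq X]
    (a : X → A) (t : OpTree Empty V X) (ht : t.leaves.Nodup) {x : X} (hx : x ∈ t.leaves) :
    ((splitRB V).pullback M).evalSum a (splitAt k x t) =
      M.eval (Function.update (fun i => M.un () (a i)) x (a x)) t.incl := by
  induction t with
  | leaf i =>
    obtain rfl : x = i := by simpa [OpTree.leaves] using hx
    rw [evalSum_splitAt_leaf]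
    simp [OpTree.incl, Interp.eval]
  | un c t ih => exact c.elim
  | bin ω l r hl hr =>
    obtain ⟨hdl, hdr, hd⟩ := List.nodup_append'.1 ht
    by_cases h : x ∈ l.leaves
    · have h' : x ∉ r.incl.leaves := fun h' => hd h (OpTree.leaves_incl r ▸ h')
      rw [evalSum_splitAt_bin_of_mem _ a ω r h, hl hdl h, OpTree.incl, Interp.eval,
        M.eval_update_of_notMem _ r.incl h', ← un_evalSum_splitAll hM]
      rfl
    · have h' : x ∉ l.incl.leaves := fun h' => h (OpTree.leaves_incl l ▸ h')
      rw [evalSum_splitAt_bin_of_notMem _ a ω r h,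
        hr hdr ((List.mem_append.1 hx).resolve_left h), OpTree.incl, Interp.eval,
        M.eval_update_of_notMem _ l.incl h', ← un_evalSum_splitAll hM]
      rfl

/-- A `P`-algebra with a Rota–Baxter operator is a `DSu(P)`-algebra. -/
theorem satisfies_dSuRel_splitRB {S : Relations k Empty V} (hM : M.Satisfies (RBRel S)) :
    ((splitRB V).pullback M).Satisfies (DSuRel S) := by
  classical
  rintro n _ ⟨r, hr, x, rfl⟩ a
  have key : ∀ z : (freeOperad k Empty V).obj (Fin n),
      ((splitRB V).pullback M).evalFree (su k x z) a =
        M.evalFree (inclFree z) (Function.update (fun i => M.un () (a i)) x (a x)) := by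
    intro z
    induction z using freeOperad_induction with
    | zero => simp only [map_zero, zero_apply]
    | add y z hy hz => simp only [map_add, add_apply, hy, hz]
    | smul_mono c t ht =>
      rw [map_smul, map_smul, smul_apply, evalFree_su_mono, map_smul, map_smul, smul_apply,
        inclFree_mono, Interp.evalFree_mono, evalSum_splitAt_splitRB hM.rotaBaxter a t ht.1 (ht.2 x)]
  rw [key]
  exact hM n _ (.base hr) _

end RotaBaxter

/-! ### Commutative and Zinbiel algebras -/

section Products

variable {k : Type u} [CommRing k] {B : Type v} [AddCommGroup B] [Module k B]
  (L : B →ₗ[k] Module.End k B) {X : Type}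

/-- The product of the left multiplications by a family of elements. -/
def mulList (b : X → B) (l : List X) : Module.End k B :=
  (l.map fun i => L (b i)).prod

variable {L}

theorem mulList_append (b : X → B) (l l' : List X) :
    mulList L b (l ++ l') = mulList L b l * mulList L b l' := by
  simp [mulList]

theorem mulList_perm (hL : ∀ x y, Commute (L x) (L y)) (b : X → B) {l l' : List X}
    (h : l.Perm l') : mulList L b l = mulList L b l' :=
  (h.map _).prod_eq' <| List.pairwise_of_forall_mem_list fun _ hx _ hy => by
    obtain ⟨i, -, rfl⟩ := List.mem_map.1 hx
    obtain ⟨j, -, rfl⟩ := List.mem_map.1 hy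
    exact hL _ _

theorem mulList_append_comm (hL : ∀ x y, Commute (L x) (L y)) (b : X → B) (l l' : List X) :
    mulList L b (l ++ l') = mulList L b l' * mulList L b l := by
  rw [mulList_perm hL b List.perm_append_comm, mulList_append]

end Products

/-- A family of elements indexed by trees, any two of which coincide, has a common value (even
if there are no trees). -/
theorem exists_forall_eq {ι : Type*} {B : Type*} [Zero B] (f : ι → B) (h : ∀ i j, f i = f j) :
    ∃ b, ∀ i, f i = b := by
  by_cases hι : Nonempty ι
  · exact ⟨f hι.some, fun i => h _ _⟩
  · exact ⟨0, fun i => (hι ⟨i⟩).elim⟩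

theorem OpTree.IsLinear.perm {U : Type} {V : Type w} {U' : Type} {V' : Type w₁} {X : Type}
    {t : OpTree U V X} {t' : OpTree U' V' X} (ht : t.IsLinear) (ht' : t'.IsLinear) :
    t.leaves.Perm t'.leaves :=
  (List.perm_ext_iff_of_nodup ht.1 ht'.1).2 fun i => by simp [ht.2 i, ht'.2 i]

theorem OpTree.leaves_ne_nil {U : Type} {V : Type w} {X : Type} (t : OpTree U V X) :
    t.leaves ≠ [] := by
  induction t with
  | leaf i => simp [leaves]
  | un c t ih => exact ih
  | bin ω l r hl hr => simp [leaves, hl]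

section Commutative

variable {k : Type u} [CommRing k] {B : Type v} [AddCommGroup B] [Module k B]
  {M : Interp k Unit Unit B}

theorem Interp.Satisfies.mul_comm (hM : M.Satisfies (RBRel (ComRel k))) (x y : B) :
    M.bin () x y = M.bin () y x :=
  (evalFree_inclFree_sub_eq_zero M).1 (hM 2 _ (.base .comm) ![x, y])

theorem Interp.Satisfies.mul_assoc (hM : M.Satisfies (RBRel (ComRel k))) (x y z : B) :
    M.bin () (M.bin () x y) z = M.bin () x (M.bin () y z) :=
  (evalFree_inclFree_sub_eq_zero M).1 (hM 3 _ (.base .assoc) ![x, y, z])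

variable {V : Type w} {X : Type}

/-- Multiplication by a product is the composite of the multiplications by its factors. -/
theorem mul_eval_incl (hM : M.Satisfies (RBRel (ComRel k))) (b : X → B) (t : OpTree Empty V X) :
    M.bin () (((collapseRB V).pullback M).eval b t.incl) = mulList (M.bin ()) b t.leaves := by
  induction t with
  | leaf i => simp [mulList, OpTree.leaves, OpTree.incl, Interp.eval]
  | un c t ih => exact c.elim
  | bin ω l r hl hr =>
    rw [OpTree.leaves, mulList_append, ← hl, ← hr, OpTree.incl]
    exact LinearMap.ext fun z => hM.mul_assoc _ _ z

theorem commute_mul (hM : M.Satisfies (RBRel (ComRel k))) (x y : B) :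
    Commute (M.bin () x : Module.End k B) (M.bin () y) :=
  LinearMap.ext fun z => by
    change M.bin () x (M.bin () y z) = M.bin () y (M.bin () x z)
    rw [← hM.mul_assoc, hM.mul_comm x y, hM.mul_assoc]

/-- A product of elements is the factor at any given leaf `x`, multiplied by all the others.  (The
factor at `x` is singled out as the algebra need not have a unit.) -/
theorem eval_incl_collapseRB [DecidableEq X] (hM : M.Satisfies (RBRel (ComRel k))) (b : X → B)
    (t : OpTree Empty V X) {x : X} (hx : x ∈ t.leaves) :
    ((collapseRB V).pullback M).eval b t.incl = mulList (M.bin ()) b (t.leaves.erase x) (b x) := by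
  induction t with
  | leaf i =>
    obtain rfl : x = i := by simpa [OpTree.leaves] using hx
    simp [mulList, OpTree.leaves, OpTree.incl, Interp.eval]
  | un c t ih => exact c.elim
  | bin ω l r hl hr =>
    by_cases h : x ∈ l.leaves
    · rw [OpTree.leaves, List.erase_append_left _ h, mulList_append_comm (commute_mul hM),
        Module.End.mul_apply, ← hl h, ← mul_eval_incl hM, OpTree.incl]
      exact hM.mul_comm _ _
    · rw [OpTree.leaves, List.erase_append_right _ h, mulList_append, Module.End.mul_apply,
        ← hr ((List.mem_append.1 hx).resolve_left h), ← mul_eval_incl hM, OpTree.incl]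
      rfl

/-- In a commutative algebra, all trees with the same leaves, each occurring once, have the same
value. -/
theorem exists_eval_incl_collapseRB (hM : M.Satisfies (RBRel (ComRel k))) (b : X → B) :
    ∃ c, ∀ t : LinTree Empty V X, ((collapseRB V).pullback M).eval b t.1.incl = c := by
  classical
  refine exists_forall_eq _ fun t s => ?_
  obtain ⟨x, hx⟩ := List.exists_mem_of_ne_nil _ t.1.leaves_ne_nil
  rw [eval_incl_collapseRB hM b t.1 hx, eval_incl_collapseRB hM b s.1 (s.2.2 x),
    mulList_perm (commute_mul hM) b ((t.2.perm s.2).erase x)]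

variable {A : Type w₁} [AddCommGroup A] [Module k A]

/-- The tensor product of a `P`-algebra and a commutative Rota–Baxter algebra is a `P`-algebra with
the Rota–Baxter operator `id ⊗ R`. -/
theorem satisfies_rBRel_tensor {S : Relations k Empty V} {N : Interp k Empty V A}
    (hN : N.Satisfies S) (hM : M.Satisfies (RBRel (ComRel k))) :
    (((forgetRB V).pullback N).tensor ((collapseRB V).pullback M)).Satisfies (RBRel S) := by
  intro n r hr a
  refine DFunLike.congr_fun (g := (0 : MultilinearMap k _ _)) (multilinear_ext_tmul ?_) a
  intro α β
  rw [zero_apply]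
  cases hr with
  | base hr =>
    rename_i r
    obtain ⟨c, hc⟩ := exists_eval_incl_collapseRB (V := V) hM β
    have key : ∀ z : (freeOperad k Empty V).obj (Fin n),
        (((forgetRB V).pullback N).tensor ((collapseRB V).pullback M)).evalFree (inclFree z)
          (fun i => α i ⊗ₜ β i) = N.evalFree z α ⊗ₜ c := by
      intro z
      induction z using freeOperad_induction with
      | zero => simp only [map_zero, zero_apply, TensorProduct.zero_tmul]
      | add y z hy hz => simp only [map_add, add_apply, hy, hz, TensorProduct.add_tmul]
      | smul_mono d t ht =>
        have h : ((forgetRB V).pullback N).eval α t.incl = N.eval α t := by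
          clear ht
          induction t with
          | leaf i => rfl
          | un c t ih => exact c.elim
          | bin ω l r hl hr => rw [Interp.eval, ← hl, ← hr, OpTree.incl]; rfl
        rw [map_smul, map_smul, smul_apply, inclFree_mono, Interp.evalFree_mono,
          Interp.tensor_eval_tmul, hc ⟨t, ht⟩, h, map_smul, smul_apply, Interp.evalFree_mono,
          TensorProduct.smul_tmul']
    rw [key, hN n r hr, TensorProduct.zero_tmul]
  | rotaBaxter ω =>
    refine (evalFree_sub_add_eq_zero _).2 ?_
    rw [Interp.tensor_eval_tmul, Interp.tensor_eval_tmul, Interp.tensor_eval_tmul]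
    change N.bin ω (α 0) (α 1) ⊗ₜ M.bin () (M.un () (β 0)) (M.un () (β 1)) =
      N.bin ω (α 0) (α 1) ⊗ₜ M.un () (M.bin () (M.un () (β 0)) (β 1)) +
        N.bin ω (α 0) (α 1) ⊗ₜ M.un () (M.bin () (β 0) (M.un () (β 1)))
    rw [hM.rotaBaxter, map_add, TensorProduct.tmul_add]

/-- A commutative Rota–Baxter algebra is a Zinbiel algebra. -/
theorem satisfies_zinbRel_zinbRB (hM : M.Satisfies (RBRel (ComRel k))) :
    (zinbRB.pullback M).Satisfies (ZinbRel k) := by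
  rintro n r ⟨⟩ a
  refine (evalFree_sub_add_eq_zero _).2 ?_
  change M.bin () (M.un () (a 0)) (M.bin () (M.un () (a 1)) (a 2)) =
    M.bin () (M.un () (M.bin () (M.un () (a 0)) (a 1))) (a 2) +
      M.bin () (M.un () (M.bin () (M.un () (a 1)) (a 0))) (a 2)
  rw [← hM.mul_assoc, hM.rotaBaxter, hM.mul_comm (a 0), map_add, map_add, LinearMap.add_apply]

end Commutative

section Zinbiel

variable {k : Type u} [CommRing k] {B : Type v} [AddCommGroup B] [Module k B]
  {M : Interp k Empty Unit B}

theorem Interp.Satisfies.zinbiel (hM : M.Satisfies (ZinbRel k)) (x y z : B) :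
    M.bin () x (M.bin () y z) = M.bin () (M.bin () x y + M.bin () y x) z := by
  rw [map_add, LinearMap.add_apply]
  exact (evalFree_sub_add_eq_zero M).1 (hM 3 _ .zinbiel ![x, y, z])

theorem commute_zinbiel (hM : M.Satisfies (ZinbRel k)) (x y : B) :
    Commute (M.bin () x : Module.End k B) (M.bin () y) :=
  LinearMap.ext fun z => by
    change M.bin () x (M.bin () y z) = M.bin () y (M.bin () x z)
    rw [hM.zinbiel, hM.zinbiel, add_comm]

variable {V : Type w} {X : Type}

/-- The Zinbiel identity: left multiplication by a value of the symmetrized product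
`ν + ν^op` is the composite of the left multiplications by its factors. -/
theorem zinbiel_evalSum_splitAll (hM : M.Satisfies (ZinbRel k)) (b : X → B)
    (t : OpTree Empty V X) :
    M.bin () (((toZinb V).pullback M).evalSum b (splitAll k t)) =
      mulList (M.bin ()) b t.leaves := by
  induction t with
  | leaf i => rw [evalSum_splitAll_leaf]; simp [mulList, OpTree.leaves]
  | un c t ih => exact c.elim
  | bin ω l r hl hr =>
    rw [OpTree.leaves, mulList_append, ← hl, ← hr, evalSum_splitAll_bin, add_comm]
    exact LinearMap.ext fun z => (hM.zinbiel _ _ z).symm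

/-- In a Zinbiel algebra, the disuccessor at `x` of a tree multiplies the argument at `x` from the
left by all the other arguments. -/
theorem evalSum_splitAt_toZinb [DecidableEq X] (hM : M.Satisfies (ZinbRel k)) (b : X → B)
    (t : OpTree Empty V X) {x : X} (hx : x ∈ t.leaves) :
    ((toZinb V).pullback M).evalSum b (splitAt k x t) =
      mulList (M.bin ()) b (t.leaves.erase x) (b x) := by
  induction t with
  | leaf i =>
    obtain rfl : x = i := by simpa [OpTree.leaves] using hx
    rw [evalSum_splitAt_leaf]
    simp [mulList, OpTree.leaves]
  | un c t ih => exact c.elim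
  | bin ω l r hl hr =>
    by_cases h : x ∈ l.leaves
    · rw [OpTree.leaves, List.erase_append_left _ h, mulList_append_comm (commute_zinbiel hM),
        Module.End.mul_apply, ← hl h, ← zinbiel_evalSum_splitAll hM,
        evalSum_splitAt_bin_of_mem _ b ω r h]
      rfl
    · rw [OpTree.leaves, List.erase_append_right _ h, mulList_append, Module.End.mul_apply,
        ← hr ((List.mem_append.1 hx).resolve_left h), ← zinbiel_evalSum_splitAll hM,
        evalSum_splitAt_bin_of_notMem _ b ω r h]
      rfl

theorem evalSum_splitAt_toZinb_eq (hM : M.Satisfies (ZinbRel k)) (b : X → B) (x : X)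
    {t s : OpTree Empty V X} (ht : t.IsLinear) (hs : s.IsLinear) :
    ((toZinb V).pullback M).evalSum b (splitAt k x t) =
      ((toZinb V).pullback M).evalSum b (splitAt k x s) := by
  classical
  rw [evalSum_splitAt_toZinb hM b t (ht.2 x), evalSum_splitAt_toZinb hM b s (hs.2 x),
    mulList_perm (commute_zinbiel hM) b ((ht.perm hs).erase x)]

section Tensor

variable {A : Type w₁} [AddCommGroup A] [Module k A] (N : Interp k Empty V A)

/-- On pure tensors, splitting affects only the Zinbiel factor. -/
theorem evalSum_splitAll_tensor (α : X → A) (β : X → B) (t : OpTree Empty V X) :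
    (((forgetSide V).pullback N).tensor ((toZinb V).pullback M)).evalSum (fun i => α i ⊗ₜ[k] β i)
        (splitAll k t) =
      N.eval α t ⊗ₜ ((toZinb V).pullback M).evalSum β (splitAll k t) := by
  induction t with
  | leaf i => rw [evalSum_splitAll_leaf, evalSum_splitAll_leaf]; rfl
  | un c t ih => exact c.elim
  | bin ω l r hl hr =>
    rw [evalSum_splitAll_bin, evalSum_splitAll_bin, hl, hr, Interp.tensor_bin_tmul,
      Interp.tensor_bin_tmul, TensorProduct.tmul_add]
    rfl

/-- On pure tensors, the disuccessor affects only the Zinbiel factor. -/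
theorem evalSum_splitAt_tensor (α : X → A) (β : X → B) (x : X) (t : OpTree Empty V X) :
    (((forgetSide V).pullback N).tensor ((toZinb V).pullback M)).evalSum (fun i => α i ⊗ₜ[k] β i)
        (splitAt k x t) =
      N.eval α t ⊗ₜ ((toZinb V).pullback M).evalSum β (splitAt k x t) := by
  induction t with
  | leaf i => rw [evalSum_splitAt_leaf, evalSum_splitAt_leaf]; rfl
  | un c t ih => exact c.elim
  | bin ω l r hl hr =>
    by_cases h : x ∈ l.leaves
    · rw [evalSum_splitAt_bin_of_mem _ _ ω r h, evalSum_splitAt_bin_of_mem _ _ ω r h, hl,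
        evalSum_splitAll_tensor, Interp.tensor_bin_tmul]
      rfl
    · rw [evalSum_splitAt_bin_of_notMem _ _ ω r h, evalSum_splitAt_bin_of_notMem _ _ ω r h, hr,
        evalSum_splitAll_tensor, Interp.tensor_bin_tmul]
      rfl

/-- The tensor product of a `P`-algebra and a Zinbiel algebra is a `DSu(P)`-algebra. -/
theorem satisfies_dSuRel_tensor {S : Relations k Empty V} {N : Interp k Empty V A}
    (hN : N.Satisfies S) (hM : M.Satisfies (ZinbRel k)) :
    (((forgetSide V).pullback N).tensor ((toZinb V).pullback M)).Satisfies (DSuRel S) := by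
  rintro n _ ⟨r, hr, x, rfl⟩ a
  refine DFunLike.congr_fun (g := (0 : MultilinearMap k _ _)) (multilinear_ext_tmul ?_) a
  intro α β
  rw [zero_apply]
  obtain ⟨c, hc⟩ := exists_forall_eq
    (fun t : LinTree Empty V (Fin n) => ((toZinb V).pullback M).evalSum β (splitAt k x t.1))
    fun t s => evalSum_splitAt_toZinb_eq hM β x t.2 s.2
  have key : ∀ z : (freeOperad k Empty V).obj (Fin n),
      (((forgetSide V).pullback N).tensor ((toZinb V).pullback M)).evalFree (su k x z)
        (fun i => α i ⊗ₜ β i) = N.evalFree z α ⊗ₜ c := by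
    intro z
    induction z using freeOperad_induction with
    | zero => simp only [map_zero, zero_apply, TensorProduct.zero_tmul]
    | add y z hy hz => simp only [map_add, add_apply, hy, hz, TensorProduct.add_tmul]
    | smul_mono d t ht =>
      rw [map_smul, map_smul, smul_apply, evalFree_su_mono, evalSum_splitAt_tensor, hc ⟨t, ht⟩,
        map_smul, smul_apply, Interp.evalFree_mono, TensorProduct.smul_tmul']
  rw [key, hN n r hr, TensorProduct.zero_tmul]

end Tensor

/-- A Zinbiel algebra is an algebra over the disuccessor of the commutative operad. -/
theorem satisfies_dSuRel_toZinb (hM : M.Satisfies (ZinbRel k)) :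
    ((toZinb Unit).pullback M).Satisfies (DSuRel (ComRel k)) := by
  rintro n _ ⟨r, hr, x, rfl⟩ a
  cases hr <;>
    exact (evalFree_su_sub_eq_zero _).2 (evalSum_splitAt_toZinb_eq hM a x
      (by simp [OpTree.IsLinear, OpTree.leaves, Fin.forall_fin_succ, -forall_const])
      (by simp [OpTree.IsLinear, OpTree.leaves, Fin.forall_fin_succ, -forall_const]))

end Zinbiel

section DSuCom

variable {k : Type u} [CommRing k] {B : Type v} [AddCommGroup B] [Module k B]
  {M : Interp k Empty (Unit × Side) B}

/-- The disuccessor of commutativity. -/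
theorem Interp.Satisfies.prec_eq_succ (hM : M.Satisfies (DSuRel (ComRel k))) (x y : B) :
    M.bin ((), .prec) x y = M.bin ((), .succ) y x := by
  have := (evalFree_su_sub_eq_zero M).1 (hM 2 _ ⟨_, .comm, 0, rfl⟩ ![x, y])
  rw [evalSum_splitAt_bin_of_mem _ _ _ _ (by simp [OpTree.leaves]),
    evalSum_splitAt_bin_of_notMem _ _ _ _ (by simp [OpTree.leaves]),
    evalSum_splitAt_leaf, evalSum_splitAll_leaf] at this
  exact this

/-- An algebra over the disuccessor of the commutative operad is a Zinbiel algebra: the Zinbiel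
identity is the disuccessor of associativity at the last leaf. -/
theorem satisfies_zinbRel_zinbSucc (hM : M.Satisfies (DSuRel (ComRel k))) :
    (zinbSucc.pullback M).Satisfies (ZinbRel k) := by
  rintro n r ⟨⟩ a
  have := (evalFree_su_sub_eq_zero M).1 (hM 3 _ ⟨_, .assoc, 2, rfl⟩ a)
  rw [evalSum_splitAt_bin_of_notMem _ _ _ _ (by simp [OpTree.leaves]),
    evalSum_splitAt_bin_of_notMem _ _ _ _ (by simp [OpTree.leaves]),
    evalSum_splitAt_bin_of_notMem _ _ _ _ (by simp [OpTree.leaves]), evalSum_splitAll_bin,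
    evalSum_splitAt_leaf, evalSum_splitAll_leaf, evalSum_splitAll_leaf,
    hM.prec_eq_succ] at this
  refine (evalFree_sub_add_eq_zero _).2 ?_
  change M.bin ((), .succ) (a 0) (M.bin ((), .succ) (a 1) (a 2)) =
    M.bin ((), .succ) (M.bin ((), .succ) (a 0) (a 1)) (a 2) +
      M.bin ((), .succ) (M.bin ((), .succ) (a 1) (a 0)) (a 2)
  rw [← this, map_add, LinearMap.add_apply, add_comm]

end DSuCom

/-! ### Algebras over presented operads -/

section Algebras

variable {k : Type u} [CommRing k] {U : Type} {V : Type w} {A : Type v} [AddCommGroup A]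
  [Module k A]

/-- Restriction of an algebra structure along a morphism of operads. -/
def Operad.Algebra.pullback {P : Operad.{u, w₁} k} {Q : Operad.{u, w₂} k} (f : Operad.Hom P Q)
    (𝒜 : Q.Algebra A) : P.Algebra A where
  act := 𝒜.act ∘ₗ f.app _
  act_map e p a := by simp only [LinearMap.comp_apply, f.app_map, 𝒜.act_map]
  act_one a := by simp only [LinearMap.comp_apply, f.app_one, 𝒜.act_one]
  act_comp p q a := by simp only [LinearMap.comp_apply, f.app_comp, 𝒜.act_comp]

/-- Algebra structures on a tensor product are equal if they agree on pure tensors. -/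
theorem Operad.Algebra.ext_tmul {P : Operad.{u, w₁} k} {B : Type w₂} [AddCommGroup B]
    [Module k B] {𝒮 𝒮' : P.Algebra (A ⊗[k] B)}
    (h : ∀ {I : Type} [Finite I] (x : P.obj I) (α : I → A) (β : I → B),
      𝒮.act x (fun i => α i ⊗ₜ β i) = 𝒮'.act x (fun i => α i ⊗ₜ β i)) : 𝒮 = 𝒮' := by
  obtain ⟨f, _, _, _⟩ := 𝒮
  obtain ⟨g, _, _, _⟩ := 𝒮'
  obtain rfl : @f = @g := by
    funext I hI
    exact LinearMap.ext fun x => multilinear_ext_tmul fun α β => h x α β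
  rfl

/-- The algebra over a presented operad given by operations that satisfy the relations. -/
noncomputable def Interp.toAlgebra (M : Interp k U V A) {S : Relations k U V}
    (hM : M.Satisfies S) : (presented S).Algebra A where
  act {I} _ := Submodule.liftQ (((freeOperad k U V).span S).carrier I) M.evalFree fun _ hz =>
    hM.evalFree_eq_zero hz
  act_map := by
    rintro _ _ _ _ e ⟨p⟩ a
    exact M.evalFree_map e p a
  act_one a := M.evalFree_mono _ isLinear_leaf_unit a
  act_comp := by
    rintro _ _ _ _ ⟨p⟩ ⟨q⟩ a
    exact M.evalFree_comp p q a

/-- The operations given by the generators of a presented operad on an algebra. -/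
noncomputable def Interp.ofAlgebra {S : Relations k U V} (𝒜 : (presented S).Algebra A) :
    Interp k U V A where
  un c := linearOfMultilinear (𝒜.act (cls S (mono _ (isLinear_leaf_unit.un c))))
  bin ω := bilinearOfMultilinear
    (𝒜.act (cls S (mono (.bin ω (.leaf 0) (.leaf 1)) (isLinear_fin_two (.inl rfl)))))

section OfAlgebra

variable {S : Relations k U V} (𝒜 : (presented S).Algebra A) {I J : Type} [Finite I] [Finite J]

theorem act_map_mono (e : I ≃ J) (t : OpTree U V I) (ht : t.IsLinear) (a : J → A) :
    𝒜.act (cls S (mono (t.map e) (ht.map e))) a = 𝒜.act (cls S (mono t ht)) fun i => a (e i) := by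
  rw [← 𝒜.act_map, ← freeOperad_map_mono]
  rfl

theorem act_graft_mono (t : OpTree U V (Option I)) (ht : t.IsLinear) (s : OpTree U V J)
    (hs : s.IsLinear) (a : I ⊕ J → A) :
    𝒜.act (cls S (mono (t.graft s) (ht.graft hs))) a =
      𝒜.act (cls S (mono t ht)) fun o =>
        o.elim (𝒜.act (cls S (mono s hs)) fun j => a (.inr j)) fun i => a (.inl i) := by
  rw [← 𝒜.act_comp, ← freeOperad_comp_mono]
  rfl

theorem act_un_mono (c : U) (t : OpTree U V I) (ht : t.IsLinear) (a : I → A) :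
    𝒜.act (cls S (mono (.un c t) (ht.un c))) a =
      (Interp.ofAlgebra 𝒜).un c (𝒜.act (cls S (mono t ht)) a) := by
  have h := act_map_mono 𝒜 (Equiv.emptySum Empty I) _ ((isLinear_un_leaf c).graft ht) a
  have h' := act_map_mono 𝒜 unitOption (.un c (.leaf ())) (isLinear_leaf_unit.un c)
  rw [act_graft_mono 𝒜 _ (isLinear_un_leaf c) t ht] at h
  refine Eq.trans ?_ (h.trans (h' _))
  congr 4
  change _ = OpTree.un c ((t.map _).map _)
  rw [OpTree.map_map]
  exact congrArg _ (OpTree.bind_leaf t).symm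

theorem act_bin_mono (ω : V) (t : OpTree U V I) (ht : t.IsLinear) (s : OpTree U V J)
    (hs : s.IsLinear) (a : I ⊕ J → A) :
    𝒜.act (cls S (mono _ (ht.bin hs ω))) a =
      (Interp.ofAlgebra 𝒜).bin ω (𝒜.act (cls S (mono t ht)) fun i => a (.inl i))
        (𝒜.act (cls S (mono s hs)) fun j => a (.inr j)) := by
  let e : Fin 2 ≃ Option Unit :=
    { toFun := ![none, some ()]
      invFun := fun o => o.elim 0 fun _ => 1
      left_inv := fun i => by fin_cases i <;> rfl
      right_inv := by rintro (_ | _) <;> rfl }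
  let e' : Unit ⊕ I ≃ Option I := (Equiv.sumComm Unit I).trans (sumUnit I)
  let b : OpTree U V (Fin 2) := .bin ω (.leaf 0) (.leaf 1)
  have hb : b.IsLinear := isLinear_fin_two (.inl rfl)
  have tree_eq : (((b.map e).graft t).map e').graft s = .bin ω (t.map .inl) (s.map .inr) := by
    change OpTree.bin ω (((t.map _).map _).bind _) _ = _
    rw [OpTree.map_map, OpTree.map_bind]
    rfl
  have h := act_graft_mono 𝒜 _ (((hb.map e).graft ht).map e') s hs a
  have h' := fun a' => (act_map_mono 𝒜 e' _ ((hb.map e).graft ht) a').trans <|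
    (act_graft_mono 𝒜 _ (hb.map e) t ht _).trans (act_map_mono 𝒜 e b hb _)
  refine Eq.trans ?_ ((h.trans (h' _)).trans ?_)
  · congr 4
    exact tree_eq.symm
  · refine congrArg (𝒜.act (cls S (mono b hb))) ?_
    funext i
    fin_cases i <;> rfl

/-- The elements of a presented operad act on an algebra as prescribed by the action of the
generators. -/
theorem ofAlgebra_evalFree (z : (freeOperad k U V).obj I) (a : I → A) :
    (Interp.ofAlgebra 𝒜).evalFree z a = 𝒜.act (cls S z) a := by
  -- Subtrees do not have all the labels in `I`, so each tree is first given its own set of labels.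
  have key : ∀ {X : Type} (t : OpTree U V X), ∃ (J : Type) (_ : Finite J) (s : OpTree U V J)
      (hs : s.IsLinear) (g : J → X), s.map g = t ∧
        ∀ a : J → A, (Interp.ofAlgebra 𝒜).eval a s = 𝒜.act (cls S (mono s hs)) a := by
    intro X t
    induction t with
    | leaf i =>
      exact ⟨Unit, inferInstance, .leaf (), isLinear_leaf_unit, fun _ => i, rfl,
        fun a => (𝒜.act_one a).symm⟩
    | un c t ih =>
      obtain ⟨J, hJ, s, hs, g, rfl, h⟩ := ih
      refine ⟨J, hJ, .un c s, hs.un c, g, rfl, fun a => ?_⟩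
      rw [act_un_mono, Interp.eval, h]
    | bin ω l r hl hr =>
      obtain ⟨J, hJ, s, hs, g, rfl, h⟩ := hl
      obtain ⟨J', hJ', s', hs', g', rfl, h'⟩ := hr
      refine ⟨J ⊕ J', inferInstance, _, hs.bin hs' ω, Sum.elim g g', ?_, fun a => ?_⟩
      · change OpTree.bin ω ((s.map _).map _) ((s'.map _).map _) = _
        rw [OpTree.map_map, OpTree.map_map]
        rfl
      · rw [act_bin_mono, Interp.eval, OpTree.map, OpTree.map, Interp.eval_bind, Interp.eval_bind,
          ← h, ← h']
        · rfl
        · exact hs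
        · exact hs'
  induction z using freeOperad_induction with
  | zero => rw [map_zero, show cls S (0 : (freeOperad k U V).obj I) = 0 from rfl, map_zero]
  | add x y hx hy =>
    rw [map_add, add_apply, hx, hy,
      show cls S (x + y) = cls S x + cls S y from rfl, map_add, add_apply]
  | smul_mono c t ht =>
    rw [map_smul, smul_apply, show cls S (c • mono t ht) = c • cls S (mono t ht) from rfl,
      map_smul, smul_apply, Interp.evalFree_mono]
    obtain ⟨J, hJ, s, hs, g, rfl, h⟩ := key t
    let e := Equiv.ofBijective g (OpTree.bijective_of_isLinear_map hs ht)
    refine congrArg _ (Eq.trans ?_ (act_map_mono 𝒜 e s hs a).symm)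
    rw [← h, OpTree.map, Interp.eval_bind]
    rfl

theorem ofAlgebra_satisfies : (Interp.ofAlgebra 𝒜).Satisfies S := by
  intro n r hr a
  rw [ofAlgebra_evalFree, show cls S r = 0 from
    (Submodule.Quotient.mk_eq_zero _).2 (Operad.InSpan.rel hr), map_zero]
  rfl

end OfAlgebra

end Algebras

/-! ### The morphisms -/

section Morphisms

open Operad

variable {k : Type u} [CommRing k] {V : Type w}

theorem presentedHom_substHom_mono {U U' : Type} {V' : Type w₁} {S : Relations k U V}
    {T : Relations k U' V'} (σ : TreeSubst U V U' V')
    (h : ∀ n, ∀ r ∈ S n, ((clsHom T).comp (substHom k σ)).app (Fin n) r = 0) {I : Type} [Finite I]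
    (t : OpTree U V I) (ht : t.IsLinear) :
    (presentedHom _ h).app I (cls S (mono t ht)) = cls T (mono (σ.apply t) (σ.isLinear_apply ht)) :=
  congrArg (cls T) (substHom_mono σ t ht)

theorem presentedHom_hadamardPair_mono {U U₁ U₂ : Type} {V₁ : Type w₁} {V₂ : Type w₂}
    {P : Operad.{u, w₃} k} {S₀ : Relations k U V} {S : Relations k U₁ V₁} {T : Relations k U₂ V₂}
    (e : Hom (presented S) P) (σ : TreeSubst U V U₁ V₁) (τ : TreeSubst U V U₂ V₂)
    (h : ∀ n, ∀ r ∈ S₀ n, (hadamardPair (e.comp ((clsHom S).comp (substHom k σ)))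
      ((clsHom T).comp (substHom k τ))).app (Fin n) r = 0) {I : Type} [Finite I]
    (t : OpTree U V I) (ht : t.IsLinear) :
    (presentedHom _ h).app I (cls S₀ (mono t ht)) =
      (e.app I (cls S (mono (σ.apply t) (σ.isLinear_apply ht))) ⊗ₜ[k]
        cls T (mono (τ.apply t) (τ.isLinear_apply ht)) : P.obj I ⊗[k] (presented T).obj I) := by
  rw [presentedHom_cls, hadamardPair_mono, ← substHom_mono, ← substHom_mono]
  rfl

/-- `φ : DSu(P) → RB(P)`. -/
noncomputable def dSuToRB (S : Relations k Empty V) : Hom (DSu S) (RB S) :=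
  presentedHom ((clsHom (RBRel S)).comp (substHom k (splitRB V))) fun n r hr =>
    clsHom_substHom_eq_zero _ fun _ _ _ _ hM => satisfies_dSuRel_splitRB hM n r hr

/-- `ζ : Zinb → RB(Com)`. -/
noncomputable def zinbToRBCom (k : Type u) [CommRing k] : Hom (Zinb k) (RBCom k) :=
  presentedHom ((clsHom (RBRel (ComRel k))).comp (substHom k zinbRB)) fun n r hr =>
    clsHom_substHom_eq_zero _ fun _ _ _ _ hM => satisfies_zinbRel_zinbRB hM n r hr

/-- `κ : DSu(Com) → Zinb`. -/
noncomputable def dSuComToZinb (k : Type u) [CommRing k] : Hom (DSu (ComRel k)) (Zinb k) :=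
  presentedHom ((clsHom (ZinbRel k)).comp (substHom k (toZinb Unit))) fun n r hr =>
    clsHom_substHom_eq_zero _ fun _ _ _ _ hM => satisfies_dSuRel_toZinb hM n r hr

/-- The inverse of `κ`. -/
noncomputable def zinbToDSuCom (k : Type u) [CommRing k] : Hom (Zinb k) (DSu (ComRel k)) :=
  presentedHom ((clsHom (DSuRel (ComRel k))).comp (substHom k zinbSucc)) fun n r hr =>
    clsHom_substHom_eq_zero _ fun _ _ _ _ hM => satisfies_zinbRel_zinbSucc hM n r hr

variable {P : Operad.{u, w₁} k} {S : Relations k Empty V}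

/-- `ψ : RB(P) → P ⊗ RB(Com)`. -/
noncomputable def rBToHadamard (e : Hom (presented S) P) : Hom (RB S) (hadamard P (RBCom k)) :=
  presentedHom (hadamardPair (e.comp ((clsHom S).comp (substHom k (forgetRB V))))
    ((clsHom (RBRel (ComRel k))).comp (substHom k (collapseRB V)))) fun n r hr =>
    hadamardPair_substHom_eq_zero e _ _ fun _ _ _ _ _ _ _ _ hN hM _ _ =>
      satisfies_rBRel_tensor hN hM n r hr _

/-- `χ : DSu(P) → P ⊗ Zinb`. -/
noncomputable def dSuToHadamard (e : Hom (presented S) P) : Hom (DSu S) (hadamard P (Zinb k)) :=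
  presentedHom (hadamardPair (e.comp ((clsHom S).comp (substHom k (forgetSide V))))
    ((clsHom (ZinbRel k)).comp (substHom k (toZinb V)))) fun n r hr =>
    hadamardPair_substHom_eq_zero e _ _ fun _ _ _ _ _ _ _ _ hN hM _ _ =>
      satisfies_dSuRel_tensor hN hM n r hr _

theorem forgetRB_splitRB {X : Type} (t : OpTree Empty (V × Side) X) :
    (forgetRB V).apply ((splitRB V).apply t) = (forgetSide V).apply t := by
  induction t with
  | leaf i => rfl
  | un c t ih => exact c.elim
  | bin c l r hl hr =>
    rw [TreeSubst.apply, TreeSubst.apply, ← hl, ← hr]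
    obtain ⟨ω, _ | _⟩ := c <;> rfl

theorem toZinb_zinbSucc {X : Type} (t : OpTree Empty Unit X) :
    (toZinb Unit).apply (zinbSucc.apply t) = t := by
  induction t with
  | leaf i => rfl
  | un c t ih => exact c.elim
  | bin c l r hl hr =>
    conv_rhs => rw [← hl, ← hr]
    rfl

/-- The two ways from `DSu(P)` to `RB(Com)` differ by the order of the factors in products. -/
theorem cls_zinbRB_toZinb {I : Type} [Finite I] (t : OpTree Empty (V × Side) I)
    (ht : t.IsLinear) :
    cls (RBRel (ComRel k)) (mono (zinbRB.apply ((toZinb V).apply t))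
        (zinbRB.isLinear_apply ((toZinb V).isLinear_apply ht))) =
      cls (RBRel (ComRel k)) (mono ((collapseRB V).apply ((splitRB V).apply t))
        ((collapseRB V).isLinear_apply ((splitRB V).isLinear_apply ht))) := by
  refine cls_eq_of_forall _ fun A _ _ M hM a => ?_
  rw [Interp.evalFree_mono, Interp.evalFree_mono, TreeSubst.eval_apply, TreeSubst.eval_apply,
    TreeSubst.eval_apply, TreeSubst.eval_apply]
  clear ht
  induction t with
  | leaf i => rfl
  | un c t ih => exact c.elim
  | bin c l r hl hr =>
    rw [Interp.eval, Interp.eval, hl, hr]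
    obtain ⟨ω, _ | _⟩ := c
    · exact hM.mul_comm _ _
    · rfl

theorem square_commutes (e : Hom (presented S) P) :
    (hadamardMap P (zinbToRBCom k)).comp (dSuToHadamard e) =
      (rBToHadamard e).comp (dSuToRB S) := by
  refine presented_hom_ext fun I _ t ht => ?_
  rw [Hom.comp_app, Hom.comp_app, dSuToHadamard, presentedHom_hadamardPair_mono, dSuToRB, presentedHom_substHom_mono,
    rBToHadamard, presentedHom_hadamardPair_mono]
  change e.app I _ ⊗ₜ (zinbToRBCom k).app I _ = _
  rw [zinbToRBCom, presentedHom_substHom_mono, cls_zinbRB_toZinb t ht]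
  congr 3
  simp only [forgetRB_splitRB]

theorem dSuComToZinb_isIso : (dSuComToZinb k).IsIso := by
  have h : (dSuComToZinb k).comp (zinbToDSuCom k) = Hom.id _ := by
    refine presented_hom_ext fun I _ t ht => ?_
    rw [Hom.comp_app, dSuComToZinb, zinbToDSuCom, presentedHom_substHom_mono, presentedHom_substHom_mono]
    simp only [toZinb_zinbSucc]
    rfl
  have h' : (zinbToDSuCom k).comp (dSuComToZinb k) = Hom.id _ := by
    refine presented_hom_ext fun I _ t ht => ?_
    rw [Hom.comp_app, dSuComToZinb, zinbToDSuCom, presentedHom_substHom_mono, presentedHom_substHom_mono]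
    refine cls_eq_of_forall (z' := mono t ht) _ fun A _ _ M hM a => ?_
    rw [Interp.evalFree_mono, Interp.evalFree_mono, TreeSubst.eval_apply, TreeSubst.eval_apply]
    clear ht
    induction t with
    | leaf i => rfl
    | un c t ih => exact c.elim
    | bin c l r hl hr =>
      rw [Interp.eval, Interp.eval, hl, hr]
      obtain ⟨ω, _ | _⟩ := c
      · exact (hM.prec_eq_succ _ _).symm
      · rfl
  intro I _
  refine Function.bijective_iff_has_inverse.2 ⟨(zinbToDSuCom k).app I, fun x => ?_, fun x => ?_⟩
  · exact LinearMap.congr_fun (congrArg (fun f => f.app I) h') x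
  · exact LinearMap.congr_fun (congrArg (fun f => f.app I) h) x

end Morphisms

/-! ### The algebra structure on a tensor product -/

section TensorAlgebra

open Operad

variable {k : Type u} [CommRing k] {V : Type w} {P : Operad.{u, w₁} k} {S : Relations k Empty V}
  (e : Hom (presented S) P) {A : Type w₂} {B : Type w₃} [AddCommGroup A] [Module k A]
  [AddCommGroup B] [Module k B] (𝒜 : P.Algebra A) (ℬ : (RBCom k).Algebra B)

/-- The operations `ω` and `R` on the tensor product of a `P`-algebra and a commutative Rota–Baxter
algebra. -/
noncomputable def tensorInterp : Interp k Unit V (A ⊗[k] B) :=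
  ((forgetRB V).pullback (Interp.ofAlgebra (𝒜.pullback e))).tensor
    ((collapseRB V).pullback (Interp.ofAlgebra ℬ))

theorem tensorInterp_satisfies : (tensorInterp e 𝒜 ℬ).Satisfies (RBRel S) :=
  satisfies_rBRel_tensor (ofAlgebra_satisfies _) (ofAlgebra_satisfies _)

/-- The `DSu(P)`-algebra structure on the tensor product of a `P`-algebra and a commutative
Rota–Baxter algebra. -/
noncomputable def tensorAlgebra : (DSu S).Algebra (A ⊗[k] B) :=
  ((splitRB V).pullback (tensorInterp e 𝒜 ℬ)).toAlgebra
    (satisfies_dSuRel_splitRB (tensorInterp_satisfies e 𝒜 ℬ))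

theorem tensorAlgebra_act_tmul {I : Type} [Finite I] (x : (DSu S).obj I) (α : I → A) (β : I → B) :
    (tensorAlgebra e 𝒜 ℬ).act x (fun i => α i ⊗ₜ β i) =
      TensorProduct.map (𝒜.eval α) (ℬ.eval β) (((rBToHadamard e).comp (dSuToRB S)).app I x) := by
  have key : (tensorAlgebra e 𝒜 ℬ).eval (fun i => α i ⊗ₜ β i) =
      TensorProduct.map (𝒜.eval α) (ℬ.eval β) ∘ₗ
        ((rBToHadamard e).comp (dSuToRB S)).app I := by
    refine Submodule.linearMap_qext _ <| freeOperad_hom_ext fun t ht => ?_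
    change ((splitRB V).pullback (tensorInterp e 𝒜 ℬ)).evalFree (mono t ht) _ =
      TensorProduct.map (𝒜.eval α) (ℬ.eval β)
        ((rBToHadamard e).app I ((dSuToRB S).app I (cls _ (mono t ht))))
    rw [dSuToRB, presentedHom_substHom_mono, rBToHadamard, presentedHom_hadamardPair_mono,
      Interp.evalFree_mono, ← TreeSubst.eval_apply, tensorInterp, Interp.tensor_eval_tmul,
      ← TreeSubst.eval_apply, ← TreeSubst.eval_apply]
    refine Eq.trans ?_ (TensorProduct.map_tmul _ _ _ _).symm
    refine congrArg₂ _ ?_ ?_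
    · exact ((Interp.evalFree_mono _ _ _ _).symm.trans
        (ofAlgebra_evalFree (𝒜.pullback e) (mono _ _) α))
    · exact ((Interp.evalFree_mono _ _ _ _).symm.trans (ofAlgebra_evalFree ℬ (mono _ _) β))
  exact LinearMap.congr_fun key x

end TensorAlgebra

end BinaryOperads

theorem mainTheorem6 {k : Type*} [Field k] [CharZero k]
    (P : Operad k) {V : Type*} (gen : V → P.obj (Fin 2)) (S : Relations k Empty V)
    (hP : IsPresentedBy P gen S) :
    (∃ κ : Operad.Hom (DSu (ComRel k)) (Zinb k), κ.IsIso ∧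
      κ.app (Fin 2) (DSu.prec (ComRel k) ()) = Zinb.nuOp k ∧
      κ.app (Fin 2) (DSu.succ (ComRel k) ()) = Zinb.nu k) ∧
    ∃ (φ : Operad.Hom (DSu S) (RB S))
      (ψ : Operad.Hom (RB S) (Operad.hadamard P (RBCom k)))
      (χ : Operad.Hom (DSu S) (Operad.hadamard P (Zinb k)))
      (ζ : Operad.Hom (Zinb k) (RBCom k)),
      (∀ ω : V, φ.app (Fin 2) (DSu.prec S ω) = RB.genR₂ S ω) ∧
      (∀ ω : V, φ.app (Fin 2) (DSu.succ S ω) = RB.genR₁ S ω) ∧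
      (∀ ω : V, ψ.app (Fin 2) (RB.gen S ω) = gen ω ⊗ₜ[k] RB.gen (ComRel k) ()) ∧
      ψ.app Unit (RB.R S) = P.one ⊗ₜ[k] RB.R (ComRel k) ∧
      (∀ ω : V, χ.app (Fin 2) (DSu.prec S ω) = gen ω ⊗ₜ[k] Zinb.nuOp k) ∧
      (∀ ω : V, χ.app (Fin 2) (DSu.succ S ω) = gen ω ⊗ₜ[k] Zinb.nu k) ∧
      ζ.app (Fin 2) (Zinb.nu k) = RB.genR₁ (ComRel k) () ∧
      (Operad.hadamardMap P ζ).comp χ = ψ.comp φ ∧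
      ∀ {A : Type*} {B : Type*} [AddCommGroup A] [Module k A] [AddCommGroup B] [Module k B]
        (𝒜 : P.Algebra A) (ℬ : (RBCom k).Algebra B),
        ∃ 𝒮 : (DSu S).Algebra (A ⊗[k] B),
          (∀ {I : Type} [Finite I] (x : (DSu S).obj I) (α : I → A) (β : I → B),
            𝒮.act x (fun i => α i ⊗ₜ[k] β i) =
              TensorProduct.map (𝒜.eval α) (ℬ.eval β) ((ψ.comp φ).app I x)) ∧
          (∀ 𝒮' : (DSu S).Algebra (A ⊗[k] B),
            (∀ {I : Type} [Finite I] (x : (DSu S).obj I) (α : I → A) (β : I → B),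
              𝒮'.act x (fun i => α i ⊗ₜ[k] β i) =
                TensorProduct.map (𝒜.eval α) (ℬ.eval β) ((ψ.comp φ).app I x)) → 𝒮' = 𝒮) ∧
          (∀ (ω : V) (α₁ α₂ : A) (β₁ β₂ : B),
            𝒮.act (DSu.prec S ω) ![α₁ ⊗ₜ[k] β₁, α₂ ⊗ₜ[k] β₂] =
              𝒜.act (gen ω) ![α₁, α₂] ⊗ₜ[k]
                ℬ.act (RB.gen (ComRel k) ()) ![β₁, ℬ.act (RB.R (ComRel k)) fun _ => β₂]) ∧
          (∀ (ω : V) (α₁ α₂ : A) (β₁ β₂ : B),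
            𝒮.act (DSu.succ S ω) ![α₁ ⊗ₜ[k] β₁, α₂ ⊗ₜ[k] β₂] =
              𝒜.act (gen ω) ![α₁, α₂] ⊗ₜ[k]
                ℬ.act (RB.gen (ComRel k) ()) ![ℬ.act (RB.R (ComRel k)) fun _ => β₁, β₂]) := by
  obtain ⟨e, -, he⟩ := hP
  have he_one : e.app Unit (cls S (mono (.leaf ()) isLinear_leaf_unit)) = P.one := e.app_one
  refine ⟨⟨dSuComToZinb k, dSuComToZinb_isIso, presentedHom_substHom_mono _ _ _ _,
    presentedHom_substHom_mono _ _ _ _⟩, dSuToRB S, rBToHadamard e, dSuToHadamard e, zinbToRBCom k,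
    fun ω => presentedHom_substHom_mono _ _ _ _, fun ω => presentedHom_substHom_mono _ _ _ _,
    fun ω => ?_, ?_, fun ω => ?_, fun ω => ?_, presentedHom_substHom_mono _ _ _ _,
    square_commutes e, ?_⟩
  · rw [← he]
    exact presentedHom_hadamardPair_mono e _ _ _ _ _
  · rw [← he_one]
    exact presentedHom_hadamardPair_mono e _ _ _ _ _
  · rw [← he]
    exact presentedHom_hadamardPair_mono e _ _ _ _ _
  · rw [← he]
    exact presentedHom_hadamardPair_mono e _ _ _ _ _
  · intro A B _ _ _ _ 𝒜 ℬ
    refine ⟨tensorAlgebra e 𝒜 ℬ, tensorAlgebra_act_tmul e 𝒜 ℬ, fun 𝒮' h => ?_, ?_, ?_⟩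
    · exact Operad.Algebra.ext_tmul fun x α β =>
        (h x α β).trans (tensorAlgebra_act_tmul e 𝒜 ℬ x α β).symm
    · intro ω α₁ α₂ β₁ β₂
      refine (Interp.evalFree_mono _ _ _ _).trans ?_
      rw [← he]
      exact Interp.tensor_bin_tmul _ _ _ _ _ _ _
    · intro ω α₁ α₂ β₁ β₂
      refine (Interp.evalFree_mono _ _ _ _).trans ?_
      rw [← he]
      exact Interp.tensor_bin_tmul _ _ _ _ _ _ _
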